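/- **Conventions.** Let $J(k)=\{1,\dots,k\}$, $k\ge 1$. Manifolds with corners are smooth (Hausdorff, second countable) with embedded boundary hypersurfaces. *Adapted coordinates* at a point $p$ of an $n$-manifold with corners are coordinates $(x_1,\dots,x_r,y_1,\dots,y_{n-r})$ centred at $p$ and giving a diffeomorphism of a neighbourhood of $p$ onto $[0,\epsilon)^r\times(-\epsilon,\epsilon)^{n-r}$ for some $\epsilon>0$. - An *interior b-map* is a smooth map $f$ such that near each point each local boundary defining function $x'_j$ pulls back to $f^*x'_j=\alpha_j\prod_i x_i^{a(j,i)}$ with $\alpha_j>0$ smooth and $a(j,i)$ non-negative integers. - A (simple) *b-fibration* is a surjective interior b-map $f$ such that near each point, in suitable adapted coordinates $x,y$ and $x',y'$, the $f^*y'_l$ are distinct members of the $y$'s and $f^*x'_j=\prod_{i\in I_j}x_i$ with the sets $I_j$ pairwise disjoint. - A *p-submanifold* is a closed connected subset that near each of its points is given by the vanishing of some of the coordinates in some adapted coordinates. A *p-embedding* is a diffeomorphism onto a p-submanifold. - A finite collection of p-submanifolds is *p-clean* if near each point of their union there are adapted coordinates $x,y$ in which each member containing the point is defined by the vanishing of some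 of the $x_j$ and of some linear functions of the $y_l$. - A *generalized product* is a contravariant functor from the category with objects the $J(k)$, $k\ge1$, and with all maps as morphisms, to connected manifolds with corners and interior b-maps, $J(k)\mapsto M[k]$, $(I:J(n)\to J(m))\mapsto (S_I:M[m]\to M[n])$, such that $\dim M[k]=\mu+(k-1)\kappa$ for some $\mu,\kappa$, injections are taken to b-fibrations with connected fibres and surjections to p-embeddings. It is *compact* if all the $M[k]$ are compact. - For a partition $\mathfrak P$ of $J(k)$ the *multidiagonal* $D_{\mathfrak P}\subset M[k]$ is the range of $S_I$ for any surjection $I:J(k)\to J(m)$ whose level sets are the parts of $\mathfrak P$. For a subset $P\subset J(k)$ with at least two elements, the *true diagonal* $D_P$ is $D_{\mathfrak P}$ for the partition consisting of $P$ and singletons. - $D\subset M[2]$ is the diagonal, the range of $M[1]\to M[2]$; $R:M[2]\to M[2]$ is the structure map of the exchange of $1$ and $2$; and $\Pi_{i,j}:M[k]\to M[2]$ is the structure map of $1\mapsto i$, $2\mapsto j$ (where $i=j$ is allowed). **Theorem.** Let $M[\cdot]$ be a compact generalized product and $k\ge 1$. 1. The multidiagonals $D_{\mathfrak P}\subset M[k]$,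 for all partitions $\mathfrak P$ of $J(k)$, form a p-clean collection which is closed under intersection. 2. The true diagonals $D_P\subset M[k]$ for single subsets $P$ form a p-clean collection which is closed under non-transversal intersection: if $D_P$ and $D_Q$ are not transversal then $D_P\cap D_Q$ is again a true diagonal. 3. Locally the diagonals are given by linear equations in $R$-odd coordinates. Precisely, let $q\in D_{\mathfrak P}$ and choose a representative in each part of $\mathfrak P$, denoting by $b(j)$ the representative of the part containing $j$. Then for each representative $b$ there are $\kappa$ functions $\zeta^{b}=(\zeta^b_1,\dots,\zeta^b_\kappa)$ near the point $\Pi_{b,b}(q)\in D$ of $M[2]$ which are odd under $R$, are among the interior coordinates $y$ of adapted coordinates on $M[2]$ at that point, and satisfy $D=\{\zeta^b=0\}$ locally, such that with $z_j=\zeta^{b(j)}\circ\Pi_{b(j),j}$ (so $z_{b}=0$ for each representative $b$) the components of all the $z_j$ with $j\neq b(j)$ are distinct members of the interior coordinates $y$ of adapted coordinates on $M[k]$ at $q$, and, in this coordinate neighbourhood, for every partition $\mathfrak Q$ refining $\mathfrak P$ $$D_{\mathfrak Q}=\{z_i=z_j\ \text{for all } i,j \text{ in the same part of } \mathfrak Q\}.$$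 -/

import Mathlib

open Set Filter Topology
open scoped Manifold ContDiff

/-- The model for `n`-dimensional manifolds with corners: the quadrant `[0, ∞)ⁿ`. -/
noncomputable abbrev QModel (n : ℕ) :
    ModelWithCorners ℝ (EuclideanSpace ℝ (Fin n)) (EuclideanQuadrant n) :=
  modelWithCornersEuclideanQuadrant n

section ManifoldsWithCorners

/-- The set `[0, ε)^B × (-ε, ε)^(Bᶜ)` in `ℝⁿ`. -/
def cornerCube {n : ℕ} (B : Finset (Fin n)) (ε : ℝ) : Set (EuclideanSpace ℝ (Fin n)) :=
  {v | (∀ i, |v i| < ε) ∧ ∀ i ∈ B, 0 ≤ v i}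

/-- Adapted coordinates at the point `p` of an `n`-manifold with corners: a diffeomorphism, taking
`p` to `0`, from an open neighbourhood of `p` onto `[0, ε)^B × (-ε, ε)^(Bᶜ)`. The coordinates
with index in `bdry = B` are the boundary defining functions `x_j` vanishing at `p`, the others are
the interior coordinates `y_l`. -/
structure AdaptedCoords (n : ℕ) {M : Type*} [TopologicalSpace M]
    [ChartedSpace (EuclideanQuadrant n) M] (p : M) where
  bdry : Finset (Fin n)
  ε : ℝ
  ε_pos : 0 < ε
  source : Set M
  isOpen_source : IsOpen source
  mem_source : p ∈ source
  toFun : M → EuclideanSpace ℝ (Fin n)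
  invFun : EuclideanSpace ℝ (Fin n) → M
  map_source : MapsTo toFun source (cornerCube bdry ε)
  map_target : MapsTo invFun (cornerCube bdry ε) source
  left_inv : LeftInvOn invFun toFun source
  right_inv : RightInvOn invFun toFun (cornerCube bdry ε)
  smooth_toFun : ContMDiffOn (QModel n) 𝓘(ℝ, EuclideanSpace ℝ (Fin n)) ∞ toFun source
  smooth_invFun :
    ContMDiffOn 𝓘(ℝ, EuclideanSpace ℝ (Fin n)) (QModel n) ∞ invFun (cornerCube bdry ε)
  centered : toFun p = 0

/-- The given functions are among the interior coordinates `y_l` of `c` (with distinct indices for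
distinct members of the family). -/
def AdaptedCoords.IncludesInterior {n : ℕ} {M : Type*} [TopologicalSpace M]
    [ChartedSpace (EuclideanQuadrant n) M] {p : M} (c : AdaptedCoords n p)
    {ι : Type*} (z : ι → M → ℝ) : Prop :=
  ∃ σ : ι ↪ {i : Fin n // i ∉ c.bdry}, ∀ a, ∀ w ∈ c.source, c.toFun w (σ a) = z a w

variable {m n : ℕ}
  {M : Type*} [TopologicalSpace M] [ChartedSpace (EuclideanQuadrant n) M]
  {N : Type*} [TopologicalSpace N] [ChartedSpace (EuclideanQuadrant m) N]

variable (n M) in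
/-- The points of the boundary of codimension exactly one. -/
def codimOneStratum : Set M := {p | ∃ c : AdaptedCoords n p, c.bdry.card = 1}

variable (n M) in
/-- The boundary hypersurfaces: the closures of the components of the codimension one stratum. -/
def boundaryHypersurfaces : Set (Set M) :=
  {H | ∃ p ∈ codimOneStratum n M, H = closure (connectedComponentIn (codimOneStratum n M) p)}

variable (n M) in
/-- All boundary hypersurfaces are embedded: each of them is near each of its points given by the
vanishing of a single local boundary defining function. -/
def HasEmbeddedBoundary : Prop :=
  ∀ H ∈ boundaryHypersurfaces n M, ∀ p ∈ H, ∃ c : AdaptedCoords n p, ∃ i ∈ c.bdry,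
    ∀ w ∈ c.source, w ∈ H ↔ c.toFun w i = 0

variable (m n) in
/-- An interior b-map `f : N → M`: a smooth map such that, near each point, each local boundary
defining function of `M` pulls back to `α ∏ x_i ^ a i`, with `α` positive and smooth and the `x_i`
the local boundary defining functions of `N`. (This does not depend on the choice of the adapted
coordinates.) -/
def IsInteriorBMap (f : N → M) : Prop :=
  ContMDiff (QModel m) (QModel n) ∞ f ∧
  ∀ p : N, ∃ (c : AdaptedCoords m p) (c' : AdaptedCoords n (f p)),
    MapsTo f c.source c'.source ∧
    ∀ j ∈ c'.bdry, ∃ (a : Fin m → ℕ) (α : N → ℝ),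
      ContMDiffOn (QModel m) 𝓘(ℝ, ℝ) ∞ α c.source ∧ (∀ w ∈ c.source, 0 < α w) ∧
      ∀ w ∈ c.source, c'.toFun (f w) j = α w * ∏ i ∈ c.bdry, c.toFun w i ^ a i

variable (m n) in
/-- A (simple) b-fibration `f : N → M`: a surjective b-map such that, near each point, there are
adapted coordinates `x, y` of `N` and `x', y'` of `M` for which the `f^* y'_l` are among the `y`,
and `f^* x'_j = ∏_{i ∈ J j} x_i` with the sets `J j` pairwise disjoint. -/
def IsBFibration (f : N → M) : Prop :=
  IsInteriorBMap m n f ∧ Function.Surjective f ∧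
  ∀ p : N, ∃ (c : AdaptedCoords m p) (c' : AdaptedCoords n (f p)),
    MapsTo f c.source c'.source ∧
    (∃ σ : {l : Fin n // l ∉ c'.bdry} ↪ {i : Fin m // i ∉ c.bdry},
      ∀ l : {l : Fin n // l ∉ c'.bdry}, ∀ w ∈ c.source,
        c'.toFun (f w) l = c.toFun w (σ l)) ∧
    ∃ J : Fin n → Finset (Fin m),
      (∀ j ∈ c'.bdry, J j ⊆ c.bdry) ∧
      (∀ j ∈ c'.bdry, ∀ j' ∈ c'.bdry, j ≠ j' → Disjoint (J j) (J j')) ∧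
      ∀ j ∈ c'.bdry, ∀ w ∈ c.source, c'.toFun (f w) j = ∏ i ∈ J j, c.toFun w i

variable (n) in
/-- A p-submanifold: a closed connected subset which near each of its points is given by the
vanishing of some of the coordinates of an adapted coordinate system. -/
def IsPSubmanifold (X : Set M) : Prop :=
  IsClosed X ∧ IsConnected X ∧
  ∀ p ∈ X, ∃ (c : AdaptedCoords n p) (A : Finset (Fin n)),
    ∀ w ∈ c.source, w ∈ X ↔ ∀ i ∈ A, c.toFun w i = 0

variable (m n) in
/-- A p-embedding: a diffeomorphism onto a p-submanifold. -/
def IsPEmbedding (f : N → M) : Prop :=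
  ContMDiff (QModel m) (QModel n) ∞ f ∧ IsPSubmanifold n (range f) ∧
  ∃ g : M → N, Function.LeftInverse g f ∧ ContMDiffOn (QModel n) (QModel m) ∞ g (range f)

variable (n) in
/-- A p-clean collection: a finite collection of p-submanifolds such that near each point `p` of
the union there are adapted coordinates `x, y` in which each member containing `p` is given by the
vanishing of some of the `x_j` and of some linear functions of the `y_l`. -/
def IsPClean (𝒟 : Set (Set M)) : Prop :=
  𝒟.Finite ∧ (∀ X ∈ 𝒟, IsPSubmanifold n X) ∧
  ∀ p ∈ ⋃₀ 𝒟, ∃ c : AdaptedCoords n p, ∀ X ∈ 𝒟, p ∈ X →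
    ∃ A ⊆ c.bdry, ∃ L : Set (({i : Fin n // i ∉ c.bdry} → ℝ) →ₗ[ℝ] ℝ),
      ∀ w ∈ c.source, w ∈ X ↔
        (∀ i ∈ A, c.toFun w i = 0) ∧ ∀ ℓ ∈ L, ℓ (fun i => c.toFun w i) = 0

variable (n) in
/-- `X` and `Y` are transversal: at each common point, the spaces of conormals (the differentials
of the functions vanishing on `X`, respectively on `Y`) meet only in zero. -/
def AreTransversal (X Y : Set M) : Prop :=
  ∀ p ∈ X ∩ Y, ∀ f g : M → ℝ,
    ContMDiffAt (QModel n) 𝓘(ℝ, ℝ) ∞ f p → ContMDiffAt (QModel n) 𝓘(ℝ, ℝ) ∞ g p →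
    (∀ᶠ w in 𝓝[X] p, f w = 0) → (∀ᶠ w in 𝓝[Y] p, g w = 0) →
    mfderiv (QModel n) 𝓘(ℝ, ℝ) f p = mfderiv (QModel n) 𝓘(ℝ, ℝ) g p →
    mfderiv (QModel n) 𝓘(ℝ, ℝ) f p = 0

end ManifoldsWithCorners

/-- A generalized product of manifolds with corners, as a contravariant functor on the category
with objects the sets `J(k) = {1, …, k}`, `k ≥ 1`, and with all maps as morphisms. To have only
positive `k`, the indices are shifted by one: `obj k` is the manifold `M[k + 1]` attached to
`J(k + 1) = Fin (k + 1)`, of dimension `μ + k κ`. -/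
structure GeneralizedProduct where
  μ : ℕ
  κ : ℕ
  obj : ℕ → Type*
  [topologicalSpace : ∀ k, TopologicalSpace (obj k)]
  [chartedSpace : ∀ k, ChartedSpace (EuclideanQuadrant (μ + k * κ)) (obj k)]
  [isManifold : ∀ k, IsManifold (QModel (μ + k * κ)) ∞ (obj k)]
  [t2Space : ∀ k, T2Space (obj k)]
  [secondCountable : ∀ k, SecondCountableTopology (obj k)]
  [connectedSpace : ∀ k, ConnectedSpace (obj k)]
  embeddedBoundary : ∀ k, HasEmbeddedBoundary (μ + k * κ) (obj k)
  /-- The structure map `S_I : M[m + 1] → M[n + 1]` of `I : J(n + 1) → J(m + 1)`. -/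
  S : ∀ {m n : ℕ}, (Fin (n + 1) → Fin (m + 1)) → obj m → obj n
  S_id : ∀ k, S (id : Fin (k + 1) → Fin (k + 1)) = id
  S_comp : ∀ {l m n : ℕ} (I : Fin (m + 1) → Fin (l + 1)) (K : Fin (n + 1) → Fin (m + 1)),
    S (I ∘ K) = S K ∘ S I
  interiorBMap : ∀ {m n : ℕ} (I : Fin (n + 1) → Fin (m + 1)),
    IsInteriorBMap (μ + m * κ) (μ + n * κ) (S I)
  bFibration : ∀ {m n : ℕ} (I : Fin (n + 1) → Fin (m + 1)), Function.Injective I →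
    IsBFibration (μ + m * κ) (μ + n * κ) (S I)
  connectedFibres : ∀ {m n : ℕ} (I : Fin (n + 1) → Fin (m + 1)), Function.Injective I →
    ∀ q : obj n, IsConnected (S I ⁻¹' {q})
  pEmbedding : ∀ {m n : ℕ} (I : Fin (n + 1) → Fin (m + 1)), Function.Surjective I →
    IsPEmbedding (μ + m * κ) (μ + n * κ) (S I)

namespace GeneralizedProduct

attribute [instance] topologicalSpace chartedSpace isManifold t2Space secondCountable
  connectedSpace

variable (G : GeneralizedProduct)

/-- The dimension `μ + k κ` of `obj k = M[k + 1]`. -/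
abbrev dim (k : ℕ) : ℕ := G.μ + k * G.κ

/-- A compact generalized product: all the manifolds are compact. (Connectedness of the manifolds
and of the fibres is part of the definition of a generalized product.) -/
def IsCompactProduct : Prop := ∀ k, CompactSpace (G.obj k)

/-- The multidiagonal `D_𝔓 ⊆ M[k + 1]` of a partition `𝔓` of `J(k + 1)`, given as an equivalence
relation: the image of `S_I` for any surjective map `I` of `J(k + 1)` to some `J(m + 1)` whose level
sets are the parts of `𝔓`. -/
def diagonal {k : ℕ} (𝔓 : Setoid (Fin (k + 1))) : Set (G.obj k) :=
  {q | ∃ (m : ℕ) (I : Fin (k + 1) → Fin (m + 1)),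
    Function.Surjective I ∧ Setoid.ker I = 𝔓 ∧ q ∈ range (G.S I)}

/-- The multidiagonal does not depend on the choice of the surjection. -/
theorem diagonal_eq_range {k m : ℕ} (I : Fin (k + 1) → Fin (m + 1))
    (hI : Function.Surjective I) : G.diagonal (Setoid.ker I) = range (G.S I) := by
  ext q
  refine ⟨?_, fun h => ⟨m, I, hI, rfl, h⟩⟩
  rintro ⟨m', I', -, hk, ⟨r, rfl⟩⟩
  have hfac : I' = (I' ∘ Function.surjInv hI) ∘ I := by
    funext a
    have h1 : (Setoid.ker I) a (Function.surjInv hI (I a)) :=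
      (Function.surjInv_eq hI (I a)).symm
    rw [← hk] at h1
    exact h1
  exact ⟨G.S (I' ∘ Function.surjInv hI) r, by
    conv_rhs => rw [hfac, G.S_comp]
    rfl⟩

/-- The partition whose only part that may not be a singleton is `P`. -/
def singlePart {k : ℕ} (P : Finset (Fin (k + 1))) : Setoid (Fin (k + 1)) where
  r a b := a = b ∨ (a ∈ P ∧ b ∈ P)
  iseqv := ⟨fun _ => Or.inl rfl, by grind, by grind⟩

/-- The collection of all multidiagonals of `M[k + 1]`. -/
def multidiagonals (k : ℕ) : Set (Set (G.obj k)) :=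
  {X | ∃ 𝔓 : Setoid (Fin (k + 1)), X = G.diagonal 𝔓}

/-- The collection of the true diagonals `D_P` of `M[k + 1]`, where `P` is a single subset of
`J(k + 1)` with at least two elements. -/
def trueDiagonals (k : ℕ) : Set (Set (G.obj k)) :=
  {X | ∃ P : Finset (Fin (k + 1)), 2 ≤ P.card ∧ X = G.diagonal (singlePart P)}

/-- The map `Π_{i,j} : M[k + 1] → M[2]` of `J(2) → J(k + 1)`, `1 ↦ i`, `2 ↦ j`. -/
def pair {k : ℕ} (i j : Fin (k + 1)) : G.obj k → G.obj 1 := G.S (m := k) (n := 1) ![i, j]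

/-- The reflection `R` of `M[2]`, given by the exchange of the two elements of `J(2)`. -/
def R : G.obj 1 → G.obj 1 := G.S (m := 1) (n := 1) ![1, 0]

/-- The diagonal `D ⊆ M[2]`, given by the map `J(2) → J(1)`. -/
def D : Set (G.obj 1) := range (G.S (m := 0) (n := 1) fun _ => 0)

/-- Near the point `d` of `M[2]` the functions `z = (z_1, …, z_κ)` are odd under `R`, they are part
of the interior coordinates of an adapted coordinate system, and `D` is given by `z = 0`. -/
def IsOddDefining (d : G.obj 1) (z : G.obj 1 → Fin G.κ → ℝ) : Prop :=
  (∃ c : AdaptedCoords (G.dim 1) d, c.IncludesInterior fun t w => z w t) ∧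
  (∀ᶠ w in 𝓝 d, z (G.R w) = -z w) ∧
  ∀ᶠ w in 𝓝 d, w ∈ G.D ↔ z w = 0

end GeneralizedProduct

/-!
The local statement about linear equations is proved first, and the other assertions are read off
from it. It is a matter of linear algebra in the tangent spaces at the points of the multidiagonals,
on which the structure maps act functorially, and of counting dimensions.

*Combinatorics.* For `q` in `M[k + 1]` the relation "the structure map of the map moving `i` to `j`
fixes `q`" is an equivalence relation, `coarsest q`, and `q` lies in `D_𝔓` exactly when `𝔓` is finer
(`mem_diagonal_iff`). So `D_𝔓 ∩ D_𝔔 = D_{𝔓 ⊔ 𝔔}`, and the multidiagonals through `q` are those of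
the partitions finer than `coarsest q`.

*Coordinates.* A multidiagonal is a p-submanifold and the range of an interior b-map with a smooth
left inverse. Hence it is cut out by interior coordinates only, as many as its codimension
(`AdaptedCoords.disjoint_bdry_of_isInteriorBMap`, `AdaptedCoords.card_add_dim`). Any equally
numerous functions that vanish on it and have independent differentials can replace these
coordinates (`AdaptedCoords.exists_replace`), and therefore define it too. This rests on an inverse
function theorem on corner cubes (`exists_smooth_inverse_on_cornerCube`).

*Odd functions.* A dimension count in the tangent space of `M[3]` shows that the reflection `R` acts
as `-1` on the normal space of `D` (`exists_dS_swap_add`). For coordinates `y` defining `D`, the odd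
functions `y - y ∘ R` thus have differentials `2 dy` and can replace the `y`
(`exists_isOddDefining`).

*Independence.* At `q` in `D_𝔓`, the differentials of the `z_j` for `j ≠ b j` are independent: an
idempotent map of `J(k + 1)` isolates a single `j`, and the b-fibration `Π_{b(j),j}` is submersive
onto the interior directions (`LocalData.exists_dual`). If `𝔔` is finer than `𝔓`, with
representatives `b'` including those of `𝔓`, the differences `z_j - z_{b' j}` vanish on `D_𝔔`, are
independent and have the right number. So `D_𝔔` is given by the equations `z_i = z_j`, all in the
same coordinates.

*Transversality.* For disjoint `P` and `Q` every coordinate ray lies in `D_P` or in `D_Q`, so no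
non-zero covector is conormal to both; if `P` and `Q` meet, `D_P ∩ D_Q = D_{P ∪ Q}`.
-/

/-! ### Corner cubes -/

section CornerCube

variable {n : ℕ} {A B : Finset (Fin n)} {δ ε : ℝ}

theorem zero_mem_cornerCube (hε : 0 < ε) : (0 : EuclideanSpace ℝ (Fin n)) ∈ cornerCube B ε :=
  ⟨fun i => by simpa using hε, fun i _ => by simp⟩

theorem cornerCube_mono (h : δ ≤ ε) :
    (cornerCube B δ : Set (EuclideanSpace ℝ (Fin n))) ⊆ cornerCube B ε :=
  fun _ hv => ⟨fun i => (hv.1 i).trans_le h, hv.2⟩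

theorem convex_cornerCube : Convex ℝ (cornerCube B ε : Set (EuclideanSpace ℝ (Fin n))) := by
  intro x hx y hy a b ha hb hab
  refine ⟨fun i => ?_, fun i hi => ?_⟩
  · have h1 := abs_lt.1 (hx.1 i)
    have h2 := abs_lt.1 (hy.1 i)
    have h3 := (convex_Ioo (-ε) ε) (mem_Ioo.2 h1) (mem_Ioo.2 h2) ha hb hab
    simpa [abs_lt] using h3
  · have h1 := hx.2 i hi
    have h2 := hy.2 i hi
    simp only [PiLp.add_apply, PiLp.smul_apply, smul_eq_mul]
    positivity

theorem isOpen_cornerCube_empty :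
    IsOpen (cornerCube ∅ ε : Set (EuclideanSpace ℝ (Fin n))) := by
  have : (cornerCube ∅ ε : Set (EuclideanSpace ℝ (Fin n))) = ⋂ i, {v | |v i| < ε} := by
    ext v; simp [cornerCube]
  rw [this]
  exact isOpen_iInter_of_finite fun i => isOpen_lt (by fun_prop) continuous_const

theorem exists_cornerCube_subset {T : Set (EuclideanSpace ℝ (Fin n))} (hT : T ∈ 𝓝 0)
    (hε : 0 < ε) : ∃ δ, 0 < δ ∧ δ ≤ ε ∧ cornerCube ∅ δ ⊆ T := by
  have hc : Continuous fun v : Fin n → ℝ => (WithLp.toLp 2 v : EuclideanSpace ℝ (Fin n)) := by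
    fun_prop
  have h0 : (fun v : Fin n → ℝ => (WithLp.toLp 2 v : EuclideanSpace ℝ (Fin n))) ⁻¹' T ∈
      𝓝 (0 : Fin n → ℝ) := hc.continuousAt.preimage_mem_nhds (by simpa using hT)
  obtain ⟨r, hr, hrT⟩ := Metric.mem_nhds_iff.1 h0
  refine ⟨min r ε, lt_min hr hε, min_le_right _ _, fun v hv => ?_⟩
  have : WithLp.ofLp v ∈ Metric.ball (0 : Fin n → ℝ) r := by
    rw [mem_ball_zero_iff, pi_norm_lt_iff hr]
    exact fun i => (hv.1 i).trans_le (min_le_left _ _)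
  exact hrT this

theorem exists_cornerCube_subset_of_mem_nhdsWithin {T : Set (EuclideanSpace ℝ (Fin n))}
    (hε : 0 < ε) (hT : T ∈ 𝓝[cornerCube B ε] 0) : ∃ δ, 0 < δ ∧ δ ≤ ε ∧ cornerCube B δ ⊆ T := by
  obtain ⟨U, hU, hUT⟩ := mem_nhdsWithin_iff_exists_mem_nhds_inter.1 hT
  obtain ⟨δ, h0, h1, h2⟩ := exists_cornerCube_subset hU hε
  exact ⟨δ, h0, h1, fun v hv =>
    hUT ⟨h2 ⟨hv.1, by simp⟩, cornerCube_mono h1 hv⟩⟩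

theorem cornerCube_mem_nhds_of_pos {x : EuclideanSpace ℝ (Fin n)} (hx : x ∈ cornerCube B ε)
    (hpos : ∀ i ∈ B, 0 < x i) : cornerCube B ε ∈ 𝓝 x := by
  have h1 : {v : EuclideanSpace ℝ (Fin n) | ∀ i ∈ B, 0 < v i} ∈ 𝓝 x := by
    refine (Filter.eventually_all_finset B).2 fun i hi => ?_
    exact (isOpen_lt continuous_const (by fun_prop)).mem_nhds (hpos i hi)
  filter_upwards [h1, isOpen_cornerCube_empty.mem_nhds (⟨hx.1, by simp⟩ : x ∈ cornerCube ∅ ε)]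
    with v hv1 hv2
  exact ⟨hv2.1, fun i hi => (hv1 i hi).le⟩

theorem uniqueDiffOn_cornerCube (hε : 0 < ε) :
    UniqueDiffOn ℝ (cornerCube B ε : Set (EuclideanSpace ℝ (Fin n))) := by
  refine uniqueDiffOn_convex convex_cornerCube
    ⟨WithLp.toLp 2 fun _ => ε / 2, mem_interior_iff_mem_nhds.2
      (cornerCube_mem_nhds_of_pos ⟨fun i => ?_, fun i _ => ?_⟩ fun i _ => ?_)⟩
  · simp only [abs_of_pos (half_pos hε)]; linarith
  · simp only; positivity
  · simp only; positivity

/-- A directional derivative read off along a ray on which the function is affine. -/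
theorem HasFDerivWithinAt.apply_eq_of_ray {E G : Type*} [NormedAddCommGroup E] [NormedSpace ℝ E]
    [NormedAddCommGroup G] [NormedSpace ℝ G] {g : E → G} {g' : E →L[ℝ] G} {K : Set E} {x w : E}
    {y : G} (hg : HasFDerivWithinAt g g' K x) (hK : ∀ᶠ s : ℝ in 𝓝[>] 0, x + s • w ∈ K)
    (h : ∀ᶠ s : ℝ in 𝓝[>] 0, g (x + s • w) = g x + s • y) : g' w = y := by
  have hpos : ∀ᶠ s : ℝ in 𝓝[>] 0, 0 < s := self_mem_nhdsWithin
  have h1 := hg.lim (α := ℝ) (l := 𝓝[>] 0) (c := fun s => s⁻¹) (d := fun s => s • w) (v := w)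
    (((continuous_id.smul continuous_const).tendsto' 0 0 (by simp)).mono_left nhdsWithin_le_nhds) hK
    (tendsto_const_nhds.congr' (by
      filter_upwards [hpos] with s hs
      rw [smul_smul, inv_mul_cancel₀ hs.ne', one_smul]))
  have h2 : Tendsto (fun s : ℝ => s⁻¹ • (g (x + s • w) - g x)) (𝓝[>] 0) (𝓝 y) :=
    tendsto_const_nhds.congr' (by
      filter_upwards [hpos, h] with s hs h
      rw [h, add_sub_cancel_left, smul_smul, inv_mul_cancel₀ hs.ne', one_smul])
  exact tendsto_nhds_unique h1 h2

theorem eventually_smul_single_mem_cornerCube (hε : 0 < ε) (j : Fin n) :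
    ∀ᶠ s : ℝ in 𝓝[>] 0, s • EuclideanSpace.single j (1 : ℝ) ∈ cornerCube B ε := by
  filter_upwards [Ioo_mem_nhdsGT hε] with s hs
  refine ⟨fun i => ?_, fun i _ => ?_⟩
  · by_cases h : i = j <;> simp [h, hε, abs_of_pos hs.1, hs.2]
  · by_cases h : i = j <;> simp [h, hs.1.le]

end CornerCube

/-! ### An inverse function theorem on corner cubes -/

section Inverse

variable {n : ℕ} {A B : Finset (Fin n)} {δ ε : ℝ}

/-- The retraction of `ℝⁿ` onto the quadrant given by the non-negativity of the coordinates in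
`B`. -/
noncomputable def quadrantRetraction (B : Finset (Fin n)) (v : EuclideanSpace ℝ (Fin n)) :
    EuclideanSpace ℝ (Fin n) :=
  WithLp.toLp 2 fun i => if i ∈ B then max (v i) 0 else v i

theorem norm_quadrantRetraction_sub_le (v w : EuclideanSpace ℝ (Fin n)) :
    ‖quadrantRetraction B v - quadrantRetraction B w‖ ≤ ‖v - w‖ := by
  rw [EuclideanSpace.norm_eq, EuclideanSpace.norm_eq]
  refine Real.sqrt_le_sqrt (Finset.sum_le_sum fun i _ => ?_)
  gcongr
  simp only [quadrantRetraction, PiLp.sub_apply, Real.norm_eq_abs]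
  split_ifs
  · exact abs_max_sub_max_le_abs _ _ _
  · exact le_rfl

theorem quadrantRetraction_eq_self {v : EuclideanSpace ℝ (Fin n)} (hv : ∀ i ∈ B, 0 ≤ v i) :
    quadrantRetraction B v = v := by
  ext i
  simp only [quadrantRetraction]
  split_ifs with h
  · exact max_eq_left (hv i h)
  · rfl

theorem quadrantRetraction_mem {v : EuclideanSpace ℝ (Fin n)} (hv : v ∈ cornerCube ∅ δ) :
    quadrantRetraction B v ∈ cornerCube B δ := by
  refine ⟨fun i => ?_, fun i hi => ?_⟩
  · have := hv.1 i
    simp only [quadrantRetraction]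
    split_ifs
    · rcases le_total 0 (v i) with h | h
      · rwa [max_eq_left h]
      · rw [max_eq_right h, abs_zero]
        exact (abs_nonneg _).trans_lt this
    · exact this
  · simp [quadrantRetraction, hi]

/-- A local right inverse of a smooth map with invertible derivatives is smooth as soon as it is
continuous, for maps between subsets of unique differentiability. -/
theorem contDiffOn_of_rightInvOn {E : Type*} [NormedAddCommGroup E] [NormedSpace ℝ E]
    [CompleteSpace E] {h g : E → E} {K S T : Set E} (hK : UniqueDiffOn ℝ K)
    (hT : UniqueDiffOn ℝ T) (hSK : S ⊆ K) (hh : ContDiffOn ℝ ∞ h K)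
    (hinv : ∀ x ∈ S, ∃ e : E ≃L[ℝ] E, (e : E →L[ℝ] E) = fderivWithin ℝ h K x)
    (hg : ContinuousOn g T) (hgS : MapsTo g T S) (hr : ∀ y ∈ T, h (g y) = y) :
    ContDiffOn ℝ ∞ g T := by
  have hder : ∀ y ∈ T, HasFDerivWithinAt g
      (ContinuousLinearMap.inverse (fderivWithin ℝ h K (g y))) T y := by
    intro y hy
    obtain ⟨e, he⟩ := hinv (g y) (hgS hy)
    rw [← he, ContinuousLinearMap.inverse_equiv]
    have hd : HasFDerivWithinAt h (e : E →L[ℝ] E) S (g y) := by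
      rw [he]
      exact ((hh.differentiableOn (by simp)) (g y) (hSK (hgS hy))).hasFDerivWithinAt.mono hSK
    exact hd.of_local_left_inverse ((hg y hy).tendsto_nhdsWithin hgS) hy
      (eventually_mem_nhdsWithin.mono hr)
  have hdiff : DifferentiableOn ℝ g T := fun y hy => (hder y hy).differentiableWithinAt
  refine contDiffOn_infty.2 fun m => ?_
  induction m with
  | zero => exact contDiffOn_zero.2 hg
  | succ m ih =>
    rw [Nat.cast_add, Nat.cast_one]
    refine contDiffOn_succ_of_fderivWithin hdiff (fun h => absurd h (by simp)) ?_
    have h1 : ContDiffOn ℝ m (fderivWithin ℝ h K) K :=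
      hh.fderivWithin hK (by exact_mod_cast le_top)
    have h2 : ContDiffOn ℝ m (fun y => fderivWithin ℝ h K (g y)) T :=
      h1.comp ih (hgS.mono_right hSK)
    refine ContDiffOn.congr (f := fun y =>
      ContinuousLinearMap.inverse (fderivWithin ℝ h K (g y))) ?_
      fun y hy => (hder y hy).fderivWithin (hT y hy)
    intro y hy
    obtain ⟨e, he⟩ := hinv (g y) (hgS hy)
    have h3 := contDiffAt_map_inverse (n := m) e
    rw [he] at h3
    exact h3.comp_contDiffWithinAt y (h2 y hy)

/-- Let `h` be a smooth map on a corner cube which preserves the coordinates outside of `A`, where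
`A` is disjoint from the set `B` of the boundary coordinates, and which fixes the points whose
`A`-coordinates vanish. If its derivative at `0` is injective, it has a smooth local inverse on a
smaller corner cube. The map is extended across the boundary by means of the Lipschitz retraction
onto the quadrant; the extension is only Lipschitz, but close to linear, so that it is a local
homeomorphism. -/
theorem exists_smooth_inverse_on_cornerCube (hAB : Disjoint A B) (hε : 0 < ε)
    {h : EuclideanSpace ℝ (Fin n) → EuclideanSpace ℝ (Fin n)}
    (hs : ContDiffOn ℝ ∞ h (cornerCube B ε))
    (hoff : ∀ v ∈ cornerCube B ε, ∀ i ∉ A, h v i = v i)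
    (hfix : ∀ v ∈ cornerCube B ε, (∀ i ∈ A, v i = 0) → h v = v)
    (hinj : Function.Injective (fderivWithin ℝ h (cornerCube B ε) 0)) :
    ∃ (δ δ' : ℝ) (g : EuclideanSpace ℝ (Fin n) → EuclideanSpace ℝ (Fin n)),
      0 < δ' ∧ δ' ≤ δ ∧ δ ≤ ε ∧ InjOn h (cornerCube B δ) ∧
      MapsTo g (cornerCube B δ') (cornerCube B δ) ∧ (∀ y ∈ cornerCube B δ', h (g y) = y) ∧
      ContDiffOn ℝ ∞ g (cornerCube B δ') := by
  set K : Set (EuclideanSpace ℝ (Fin n)) := cornerCube B ε with hKdef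
  have hK : UniqueDiffOn ℝ K := uniqueDiffOn_cornerCube hε
  have h0K : (0 : EuclideanSpace ℝ (Fin n)) ∈ K := zero_mem_cornerCube hε
  have hd : ∀ x ∈ K, HasFDerivWithinAt h (fderivWithin ℝ h K x) K x := fun x hx =>
    (hs.differentiableOn (by simp) x hx).hasFDerivWithinAt
  obtain ⟨L, hL⟩ : ∃ L : EuclideanSpace ℝ (Fin n) ≃L[ℝ] EuclideanSpace ℝ (Fin n),
      (L : EuclideanSpace ℝ (Fin n) →L[ℝ] EuclideanSpace ℝ (Fin n)) = fderivWithin ℝ h K 0 :=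
    ⟨(LinearEquiv.ofInjectiveEndo (fderivWithin ℝ h K 0 : _ →ₗ[ℝ] _) hinj).toContinuousLinearEquiv,
      by ext v; rfl⟩
  have hh0 : h 0 = 0 := hfix 0 h0K (by simp)
  -- the derivative at `0` is the identity on the vectors whose `A`-coordinates vanish
  have hLfix : ∀ w : EuclideanSpace ℝ (Fin n), (∀ i ∈ A, w i = 0) → L w = w := by
    have hbasis : ∀ j ∉ A, L (EuclideanSpace.single j (1 : ℝ)) = EuclideanSpace.single j 1 := by
      intro j hj
      have h1 := hd 0 h0K
      rw [← hL] at h1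
      refine h1.apply_eq_of_ray (by simpa using eventually_smul_single_mem_cornerCube hε j) ?_
      filter_upwards [eventually_smul_single_mem_cornerCube (B := B) hε j] with s hs'
      simp only [hh0, zero_add]
      refine hfix _ hs' fun i hi => ?_
      have : i ≠ j := fun h => hj (h ▸ hi)
      simp [this]
    intro w hw
    have hsum : w = ∑ i, w i • EuclideanSpace.single i (1 : ℝ) := by
      ext j; simp [Finset.sum_apply, Pi.single_apply]
    conv_lhs => rw [hsum]
    conv_rhs => rw [hsum]
    rw [map_sum]
    refine Finset.sum_congr rfl fun i _ => ?_
    by_cases hi : i ∈ A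
    · simp [hw i hi]
    · rw [map_smul, hbasis i hi]
  obtain ⟨c, hc0, hc⟩ : ∃ c : NNReal, 0 < c ∧ (Subsingleton (EuclideanSpace ℝ (Fin n)) ∨
      c < ‖(L.symm : EuclideanSpace ℝ (Fin n) →L[ℝ] EuclideanSpace ℝ (Fin n))‖₊⁻¹) := by
    rcases L.subsingleton_or_nnnorm_symm_pos with h | h
    · exact ⟨1, one_pos, Or.inl h⟩
    · exact ⟨_, half_pos (inv_pos.2 h), Or.inr (half_lt_self (inv_pos.2 h))⟩
  have hcont : ContinuousWithinAt (fderivWithin ℝ h K) K 0 :=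
    hs.continuousOn_fderivWithin hK (by simp) 0 h0K
  obtain ⟨δ, hδ0, hδε, hδ⟩ := exists_cornerCube_subset_of_mem_nhdsWithin hε
    (inter_mem (hcont.preimage_mem_nhdsWithin
        (Metric.closedBall_mem_nhds _ (NNReal.coe_pos.2 hc0)))
      (hcont.preimage_mem_nhdsWithin (hL ▸ L.nhds)))
  have hδK : cornerCube B δ ⊆ K := cornerCube_mono hδε
  have happ : ∀ x ∈ cornerCube B δ, ∀ y ∈ cornerCube B δ,
      ‖h x - h y - L (x - y)‖ ≤ c * ‖x - y‖ := by
    intro x hx y hy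
    refine convex_cornerCube.norm_image_sub_le_of_norm_hasFDerivWithin_le'
      (φ := (L : EuclideanSpace ℝ (Fin n) →L[ℝ] EuclideanSpace ℝ (Fin n)))
      (fun z hz => (hd z (hδK hz)).mono hδK) (fun z hz => ?_) hy hx
    have := (hδ hz).1
    rw [hL]
    simpa [dist_eq_norm] using this
  let Φ : EuclideanSpace ℝ (Fin n) → EuclideanSpace ℝ (Fin n) := fun v =>
    h (quadrantRetraction B v) + (v - quadrantRetraction B v)
  have hΦ : ApproximatesLinearOn Φ (L : _ →L[ℝ] EuclideanSpace ℝ (Fin n)) (cornerCube ∅ δ) c := by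
    intro x hx y hy
    have hz : L ((x - quadrantRetraction B x) - (y - quadrantRetraction B y)) =
        (x - quadrantRetraction B x) - (y - quadrantRetraction B y) := by
      refine hLfix _ fun i hi => ?_
      have : i ∉ B := Finset.disjoint_left.1 hAB hi
      simp [quadrantRetraction, this]
    have hxy : x - y = (quadrantRetraction B x - quadrantRetraction B y) +
        ((x - quadrantRetraction B x) - (y - quadrantRetraction B y)) := by abel
    have : Φ x - Φ y - L (x - y) = h (quadrantRetraction B x) - h (quadrantRetraction B y) -
        L (quadrantRetraction B x - quadrantRetraction B y) := by
      conv_lhs => rw [hxy, map_add, hz]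
      simp only [Φ]
      abel
    change ‖Φ x - Φ y - L (x - y)‖ ≤ _
    rw [this]
    refine (happ _ (quadrantRetraction_mem hx) _ (quadrantRetraction_mem hy)).trans ?_
    gcongr
    exact norm_quadrantRetraction_sub_le _ _
  let e := hΦ.toOpenPartialHomeomorph Φ (cornerCube ∅ δ) hc isOpen_cornerCube_empty
  have heq : ∀ v ∈ cornerCube B δ, e v = h v := fun v hv => by
    change h _ + (v - _) = h v
    rw [quadrantRetraction_eq_self hv.2, sub_self, add_zero]
  have hsub : (cornerCube B δ : Set (EuclideanSpace ℝ (Fin n))) ⊆ e.source :=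
    fun v hv => ⟨hv.1, by simp⟩
  have h0 : (0 : EuclideanSpace ℝ (Fin n)) ∈ e.target := by
    have := e.map_source (hsub (zero_mem_cornerCube hδ0))
    rwa [heq 0 (zero_mem_cornerCube hδ0), hh0] at this
  obtain ⟨δ', hδ'0, hδ'δ, hδ'⟩ := exists_cornerCube_subset (e.open_target.mem_nhds h0) hδ0
  have htar : (cornerCube B δ' : Set (EuclideanSpace ℝ (Fin n))) ⊆ e.target :=
    fun v hv => hδ' ⟨hv.1, by simp⟩
  have hmaps : MapsTo e.symm (cornerCube B δ') (cornerCube B δ) := by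
    intro y hy
    have h1 : e.symm y ∈ cornerCube ∅ δ := e.map_target (htar hy)
    refine ⟨h1.1, fun i hi => ?_⟩
    have h2 : Φ (e.symm y) = y := e.right_inv (htar hy)
    have h3 : Φ (e.symm y) i = e.symm y i := by
      simp only [Φ, PiLp.add_apply, PiLp.sub_apply]
      rw [hoff _ (hδK (quadrantRetraction_mem h1)) i (Finset.disjoint_right.1 hAB hi)]
      ring
    rw [← h3, h2]
    exact hy.2 i hi
  have hright : ∀ y ∈ cornerCube B δ', h (e.symm y) = y := fun y hy => by
    rw [← heq _ (hmaps hy), e.right_inv (htar hy)]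
  refine ⟨δ, δ', e.symm, hδ'0, hδ'δ, hδε, ?_, hmaps, hright, ?_⟩
  · exact (e.injOn.mono hsub).congr fun v hv => heq v hv
  · exact contDiffOn_of_rightInvOn hK (uniqueDiffOn_cornerCube hδ'0) hδK hs
      (fun x hx => (hδ hx).2) (e.continuousOn_symm.mono htar) hmaps hright

end Inverse

/-! ### Differentials in adapted coordinates -/

section Differential

variable {m n l : ℕ}
  {M : Type*} [TopologicalSpace M] [ChartedSpace (EuclideanQuadrant n) M]
  {N : Type*} [TopologicalSpace N] [ChartedSpace (EuclideanQuadrant m) N]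
  {K : Type*} [TopologicalSpace K] [ChartedSpace (EuclideanQuadrant l) K]

variable (m n) in
/-- The differential of a map of manifolds with corners, as a linear map of the model spaces. All
tangent spaces of an `n`-manifold with corners are `ℝⁿ`, also at the boundary. -/
noncomputable def dmap (f : N → M) (p : N) :
    EuclideanSpace ℝ (Fin m) →L[ℝ] EuclideanSpace ℝ (Fin n) :=
  mfderiv (QModel m) (QModel n) f p

variable (n) in
/-- The differential of a real function on a manifold with corners. -/
noncomputable def dfun (f : M → ℝ) (p : M) : EuclideanSpace ℝ (Fin n) →L[ℝ] ℝ :=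
  mfderiv (QModel n) 𝓘(ℝ, ℝ) f p

theorem dmap_comp {g : M → K} {f : N → M} {p : N}
    (hg : MDifferentiableAt (QModel n) (QModel l) g (f p))
    (hf : MDifferentiableAt (QModel m) (QModel n) f p) :
    dmap m l (g ∘ f) p = (dmap n l g (f p)).comp (dmap m n f p) :=
  mfderiv_comp p hg hf

theorem dmap_id {p : M} : dmap n n (id : M → M) p = ContinuousLinearMap.id ℝ _ :=
  mfderiv_id

theorem dfun_comp {g : M → ℝ} {f : N → M} {p : N}
    (hg : MDifferentiableAt (QModel n) 𝓘(ℝ, ℝ) g (f p))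
    (hf : MDifferentiableAt (QModel m) (QModel n) f p) :
    dfun m (fun w => g (f w)) p = (dfun n g (f p)).comp (dmap m n f p) :=
  mfderiv_comp p hg hf

theorem dfun_sub {g f : M → ℝ} {p : M}
    (hg : MDifferentiableAt (QModel n) 𝓘(ℝ, ℝ) g p)
    (hf : MDifferentiableAt (QModel n) 𝓘(ℝ, ℝ) f p) :
    dfun n (fun w => g w - f w) p = dfun n g p - dfun n f p :=
  (hg.hasMFDerivAt.sub hf.hasMFDerivAt).mfderiv

theorem dfun_eq_of_eventuallyEq {g f : M → ℝ} {p : M} (h : g =ᶠ[𝓝 p] f) :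
    dfun n g p = dfun n f p :=
  h.mfderiv_eq

theorem dfun_eq_zero_of_eventually {g : M → ℝ} {p : M} (h : ∀ᶠ w in 𝓝 p, g w = 0) :
    dfun n g p = 0 := by
  rw [dfun_eq_of_eventuallyEq (f := fun _ => 0) h]
  exact mfderiv_const

namespace AdaptedCoords

variable {p : M} (c : AdaptedCoords n p)

/-- The coordinate frame at the point `w`: the differential of the inverse of the coordinate
map. -/
noncomputable def frame (w : M) :
    EuclideanSpace ℝ (Fin n) →L[ℝ] EuclideanSpace ℝ (Fin n) :=
  mfderivWithin 𝓘(ℝ, EuclideanSpace ℝ (Fin n)) (QModel n) c.invFun (cornerCube c.bdry c.ε)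
    (c.toFun w)

/-- The coordinate vector `∂_i` at the centre of the coordinate system. -/
noncomputable def vec (i : Fin n) : EuclideanSpace ℝ (Fin n) :=
  c.frame p (EuclideanSpace.single i 1)

theorem source_mem_nhds {w : M} (hw : w ∈ c.source) : c.source ∈ 𝓝 w :=
  c.isOpen_source.mem_nhds hw

theorem invFun_zero : c.invFun 0 = p := by
  rw [← c.centered, c.left_inv c.mem_source]

theorem contMDiffOn_coord (i : Fin n) :
    ContMDiffOn (QModel n) 𝓘(ℝ, ℝ) ∞ (fun w => c.toFun w i) c.source :=
  ((EuclideanSpace.proj i : EuclideanSpace ℝ (Fin n) →L[ℝ] ℝ).contMDiff).comp_contMDiffOn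
    c.smooth_toFun

theorem mdifferentiableAt_coord {w : M} (hw : w ∈ c.source) (i : Fin n) :
    MDifferentiableAt (QModel n) 𝓘(ℝ, ℝ) (fun w => c.toFun w i) w :=
  ((c.contMDiffOn_coord i).contMDiffAt (c.source_mem_nhds hw)).mdifferentiableAt (by simp)

theorem hasFDerivWithinAt_comp_invFun {g : M → ℝ} {w : M} (hw : w ∈ c.source)
    (hg : MDifferentiableAt (QModel n) 𝓘(ℝ, ℝ) g w) :
    HasFDerivWithinAt (fun x => g (c.invFun x)) ((dfun n g w).comp (c.frame w))
      (cornerCube c.bdry c.ε) (c.toFun w) := by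
  have h1 : MDifferentiableWithinAt 𝓘(ℝ, EuclideanSpace ℝ (Fin n)) (QModel n) c.invFun
      (cornerCube c.bdry c.ε) (c.toFun w) :=
    (c.smooth_invFun _ (c.map_source hw)).mdifferentiableWithinAt (by simp)
  have h2 : MDifferentiableAt (QModel n) 𝓘(ℝ, ℝ) g (c.invFun (c.toFun w)) := by
    rwa [c.left_inv hw]
  have h3 := (h2.hasMFDerivAt.comp_hasMFDerivWithinAt _ h1.hasMFDerivWithinAt).hasFDerivWithinAt
  have h4 : dfun n g w = dfun n g (c.invFun (c.toFun w)) := by rw [c.left_inv hw]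
  rw [h4]
  exact h3

theorem dfun_coord_frame {w : M} (hw : w ∈ c.source) (i : Fin n)
    (v : EuclideanSpace ℝ (Fin n)) : dfun n (fun w => c.toFun w i) w (c.frame w v) = v i := by
  have h1 := c.hasFDerivWithinAt_comp_invFun hw (c.mdifferentiableAt_coord hw i)
  have h2 : HasFDerivWithinAt (fun x => c.toFun (c.invFun x) i)
      (EuclideanSpace.proj i : EuclideanSpace ℝ (Fin n) →L[ℝ] ℝ)
      (cornerCube c.bdry c.ε) (c.toFun w) :=
    (EuclideanSpace.proj i : EuclideanSpace ℝ (Fin n) →L[ℝ] ℝ).hasFDerivWithinAt.congr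
      (fun x hx => by rw [c.right_inv hx]; rfl)
      (by rw [c.right_inv (c.map_source hw)]; rfl)
  have h3 := (uniqueDiffOn_cornerCube c.ε_pos _ (c.map_source hw)).eq h1 h2
  exact congrArg (fun L => L v) h3

theorem frame_surjective {w : M} (hw : w ∈ c.source) : Function.Surjective (c.frame w) := by
  refine (LinearMap.injective_iff_surjective (f := (c.frame w).toLinearMap)).1 fun x y hxy => ?_
  ext i
  rw [← c.dfun_coord_frame hw i x, ← c.dfun_coord_frame hw i y]
  exact congrArg _ hxy

theorem dfun_coord_vec (i j : Fin n) :
    dfun n (fun w => c.toFun w i) p (c.vec j) = if i = j then 1 else 0 := by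
  rw [vec, c.dfun_coord_frame c.mem_source, PiLp.single_apply]

theorem eq_sum_vec (v : EuclideanSpace ℝ (Fin n)) :
    v = ∑ i, dfun n (fun w => c.toFun w i) p v • c.vec i := by
  obtain ⟨x, rfl⟩ := c.frame_surjective c.mem_source v
  simp only [c.dfun_coord_frame c.mem_source, vec, ← map_smul, ← map_sum]
  congr 1
  ext j
  simp [Finset.sum_apply, Pi.single_apply]

theorem eq_of_dfun_coord_eq {v v' : EuclideanSpace ℝ (Fin n)}
    (h : ∀ i, dfun n (fun w => c.toFun w i) p v = dfun n (fun w => c.toFun w i) p v') : v = v' := by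
  rw [c.eq_sum_vec v, c.eq_sum_vec v']
  simp only [h]

theorem tendsto_invFun_nhdsWithin :
    Tendsto c.invFun (𝓝[cornerCube c.bdry c.ε] 0) (𝓝 p) := by
  have := c.smooth_invFun.continuousOn 0 (zero_mem_cornerCube c.ε_pos)
  rwa [ContinuousWithinAt, c.invFun_zero] at this

theorem hasFDerivWithinAt_comp_invFun_zero {g : M → ℝ}
    (hg : MDifferentiableAt (QModel n) 𝓘(ℝ, ℝ) g p) :
    HasFDerivWithinAt (fun x => g (c.invFun x)) ((dfun n g p).comp (c.frame p))
      (cornerCube c.bdry c.ε) 0 := by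
  simpa only [c.centered] using c.hasFDerivWithinAt_comp_invFun c.mem_source hg

theorem eventually_ray (i : Fin n) {P : M → Prop} (hP : ∀ᶠ w in 𝓝 p, P w) :
    ∀ᶠ s : ℝ in 𝓝[>] 0, P (c.invFun (s • EuclideanSpace.single i (1 : ℝ))) := by
  refine (c.tendsto_invFun_nhdsWithin.comp
    (tendsto_nhdsWithin_iff.2 ⟨?_, ?_⟩)).eventually hP
  · exact ((continuous_id.smul continuous_const).tendsto' 0 0 (by simp)).mono_left
      nhdsWithin_le_nhds
  · exact eventually_smul_single_mem_cornerCube c.ε_pos i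

/-- The coordinate vectors annihilate the functions which vanish on the coordinate rays. -/
theorem dfun_vec_eq_zero_of_ray {g : M → ℝ} {i : Fin n}
    (hg : MDifferentiableAt (QModel n) 𝓘(ℝ, ℝ) g p) (h0 : g p = 0)
    (h : ∀ᶠ s : ℝ in 𝓝[>] 0, g (c.invFun (s • EuclideanSpace.single i (1 : ℝ))) = 0) :
    dfun n g p (c.vec i) = 0 := by
  refine (c.hasFDerivWithinAt_comp_invFun_zero hg).apply_eq_of_ray
    (by simpa using eventually_smul_single_mem_cornerCube c.ε_pos i) ?_
  filter_upwards [h] with s hs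
  simp only [zero_add, hs, c.invFun_zero, h0, smul_zero]

/-- The differential at `p` of a non-negative function vanishing at `p` annihilates the interior
coordinate vectors of all adapted coordinate systems at `p`: these are tangent to curves which
extend in both directions. -/
theorem dfun_vec_eq_zero_of_nonneg {g : M → ℝ} {i : Fin n} (hi : i ∉ c.bdry)
    (hg : MDifferentiableAt (QModel n) 𝓘(ℝ, ℝ) g p) (h0 : g p = 0)
    (h : ∀ᶠ w in 𝓝 p, 0 ≤ g w) : dfun n g p (c.vec i) = 0 := by
  have hline : Continuous fun s : ℝ => s • EuclideanSpace.single i (1 : ℝ) :=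
    continuous_id.smul continuous_const
  have hmem : ∀ᶠ s : ℝ in 𝓝 0, s • EuclideanSpace.single i (1 : ℝ) ∈
      cornerCube c.bdry c.ε := by
    filter_upwards [Ioo_mem_nhds (neg_lt_zero.2 c.ε_pos) c.ε_pos] with s hs
    refine ⟨fun j => ?_, fun j hj => ?_⟩
    · by_cases h : j = i
      · simpa [h, abs_lt] using hs
      · simp [h, c.ε_pos]
    · have : j ≠ i := fun h => hi (h ▸ hj)
      simp [this]
  have hd : HasDerivAt (fun s : ℝ => s • EuclideanSpace.single i (1 : ℝ))
      (EuclideanSpace.single i (1 : ℝ)) 0 := by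
    simpa using (hasDerivAt_id (0 : ℝ)).smul_const (EuclideanSpace.single i (1 : ℝ))
  have h1 := c.hasFDerivWithinAt_comp_invFun_zero hg
  rw [← zero_smul ℝ (EuclideanSpace.single i (1 : ℝ))] at h1
  have h2 := (h1.comp_hasDerivWithinAt (0 : ℝ) (hd.hasDerivWithinAt (s := {s : ℝ |
    s • EuclideanSpace.single i (1 : ℝ) ∈ cornerCube c.bdry c.ε})) fun s hs => hs).hasDerivAt hmem
  refine IsLocalMin.hasDerivAt_eq_zero ?_ h2
  have h3 : Tendsto (fun s : ℝ => c.invFun (s • EuclideanSpace.single i (1 : ℝ))) (𝓝 0) (𝓝 p) :=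
    c.tendsto_invFun_nhdsWithin.comp
      (tendsto_nhdsWithin_iff.2 ⟨hline.tendsto' 0 0 (by simp), hmem⟩)
  filter_upwards [h3.eventually h] with s hs
  simpa [c.invFun_zero, h0] using hs

/-- At the points where all the boundary defining functions are positive, the differential of a
non-negative function vanishes where the function does. -/
theorem dfun_eq_zero_of_nonneg_of_pos {g : M → ℝ} {w : M} (hw : w ∈ c.source)
    (hpos : ∀ i ∈ c.bdry, 0 < c.toFun w i)
    (hg : MDifferentiableAt (QModel n) 𝓘(ℝ, ℝ) g w) (h0 : g w = 0)
    (h : ∀ᶠ w in 𝓝 w, 0 ≤ g w) : dfun n g w = 0 := by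
  have hK := cornerCube_mem_nhds_of_pos (c.map_source hw) hpos
  have h1 := (c.hasFDerivWithinAt_comp_invFun hw hg).hasFDerivAt hK
  have h2 : Tendsto c.invFun (𝓝 (c.toFun w)) (𝓝 w) := by
    have := (c.smooth_invFun.continuousOn _ (c.map_source hw)).continuousAt hK
    rwa [ContinuousAt, c.left_inv hw] at this
  have h3 : (dfun n g w).comp (c.frame w) = 0 := by
    refine IsLocalMin.hasFDerivAt_eq_zero ?_ h1
    filter_upwards [h2.eventually h] with x hx
    simpa [c.left_inv hw, h0] using hx
  ext v
  obtain ⟨x, rfl⟩ := c.frame_surjective hw v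
  exact congrArg (fun L => L x) h3

/-- Restriction of adapted coordinates to a smaller cube. -/
def shrink {δ : ℝ} (h0 : 0 < δ) (hδ : δ ≤ c.ε) : AdaptedCoords n p where
  bdry := c.bdry
  ε := δ
  ε_pos := h0
  source := c.source ∩ c.toFun ⁻¹' cornerCube ∅ δ
  isOpen_source :=
    c.smooth_toFun.continuousOn.isOpen_inter_preimage c.isOpen_source isOpen_cornerCube_empty
  mem_source := ⟨c.mem_source, by
    rw [mem_preimage, c.centered]; exact zero_mem_cornerCube h0⟩
  toFun := c.toFun
  invFun := c.invFun
  map_source := fun _ hw => ⟨hw.2.1, (c.map_source hw.1).2⟩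
  map_target := fun x hx => ⟨c.map_target (cornerCube_mono hδ hx), by
    rw [mem_preimage, c.right_inv (cornerCube_mono hδ hx)]; exact ⟨hx.1, by simp⟩⟩
  left_inv := fun _ hw => c.left_inv hw.1
  right_inv := fun _ hx => c.right_inv (cornerCube_mono hδ hx)
  smooth_toFun := c.smooth_toFun.mono inter_subset_left
  smooth_invFun := c.smooth_invFun.mono (cornerCube_mono hδ)
  centered := c.centered

theorem exists_shrink_subset {V : Set M} (hV : V ∈ 𝓝 p) :
    ∃ (δ : ℝ) (h0 : 0 < δ) (hδ : δ ≤ c.ε), (c.shrink h0 hδ).source ⊆ V := by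
  obtain ⟨δ, h0, hδ, h⟩ := exists_cornerCube_subset_of_mem_nhdsWithin c.ε_pos
    (c.tendsto_invFun_nhdsWithin hV)
  refine ⟨δ, h0, hδ, fun w hw => ?_⟩
  have := h ((c.shrink h0 hδ).map_source hw)
  rwa [mem_preimage, show (c.shrink h0 hδ).toFun w = c.toFun w from rfl, c.left_inv hw.1] at this

end AdaptedCoords

end Differential

/-! ### Changing adapted coordinates -/

section Replace

variable {n : ℕ} {M : Type*} [TopologicalSpace M] [ChartedSpace (EuclideanQuadrant n) M] {p : M}

/-- Let `A` be a set of interior coordinates, and let the functions `u_i`, `i ∈ A`, vanish where all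
the coordinates in `A` do. If the differentials of the `u_i` are independent, as witnessed by a dual
family of vectors, then the `u_i` can replace the coordinates in `A` in a smaller adapted coordinate
system, and they have the same common zeros there. -/
theorem AdaptedCoords.exists_replace (c : AdaptedCoords n p) {A : Finset (Fin n)}
    (hA : Disjoint A c.bdry) {u : Fin n → M → ℝ} {V : Set M} (hV : V ∈ 𝓝 p)
    (hu : ∀ i ∈ A, ContMDiffOn (QModel n) 𝓘(ℝ, ℝ) ∞ (u i) V)
    (hvan : ∀ w ∈ V, w ∈ c.source → (∀ i ∈ A, c.toFun w i = 0) → ∀ i ∈ A, u i w = 0)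
    {v : Fin n → EuclideanSpace ℝ (Fin n)}
    (hv : ∀ i ∈ A, ∀ j ∈ A, dfun n (u i) p (v j) = if i = j then 1 else 0) :
    ∃ c' : AdaptedCoords n p, c'.source ⊆ V ∩ c.source ∧ c'.bdry = c.bdry ∧
      (∀ w ∈ c'.source, ∀ i ∈ A, c'.toFun w i = u i w) ∧
      (∀ w ∈ c'.source, ∀ i ∉ A, c'.toFun w i = c.toFun w i) ∧
      ∀ w ∈ c'.source, (∀ i ∈ A, u i w = 0) → ∀ i ∈ A, c.toFun w i = 0 := by
  obtain ⟨δ₀, hδ₀, hδ₀ε, hδ₀V⟩ := c.exists_shrink_subset hV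
  let c₀ := c.shrink hδ₀ hδ₀ε
  set K : Set (EuclideanSpace ℝ (Fin n)) := cornerCube c.bdry δ₀
  have hpV : p ∈ V := mem_of_mem_nhds hV
  have h0K : (0 : EuclideanSpace ℝ (Fin n)) ∈ K := zero_mem_cornerCube hδ₀
  have hinvV : MapsTo c.invFun K V := fun x hx => hδ₀V (c₀.map_target hx)
  have hinvs : MapsTo c.invFun K c.source := fun x hx => (c₀.map_target hx).1
  have hright : ∀ x ∈ K, c.toFun (c.invFun x) = x := fun x hx => c₀.right_inv hx
  have hup : ∀ i ∈ A, u i p = 0 := hvan p hpV c.mem_source (by simp [c.centered])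
  have hud : ∀ i ∈ A, MDifferentiableAt (QModel n) 𝓘(ℝ, ℝ) (u i) p := fun i hi =>
    ((hu i hi).contMDiffAt hV).mdifferentiableAt (by simp)
  -- the functions `u` do not vary in the direction of the remaining coordinates
  have hray : ∀ i ∈ A, ∀ j ∉ A, dfun n (u i) p (c.vec j) = 0 := by
    intro i hi j hj
    refine c.dfun_vec_eq_zero_of_ray (hud i hi) (hup i hi) ?_
    filter_upwards [eventually_smul_single_mem_cornerCube (B := c.bdry) hδ₀ j] with s hs
    refine hvan _ (hinvV hs) (hinvs hs) (fun k hk => ?_) i hi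
    have : k ≠ j := fun h => hj (h ▸ hk)
    rw [hright _ hs]
    simp [this]
  let h : EuclideanSpace ℝ (Fin n) → EuclideanSpace ℝ (Fin n) := fun x =>
    WithLp.toLp 2 fun i => if i ∈ A then u i (c.invFun x) else x i
  have hh : ContDiffOn ℝ ∞ h K := by
    refine contDiffOn_euclidean.2 fun i => ?_
    by_cases hi : i ∈ A
    · simp only [h, hi, if_true]
      exact ((hu i hi).comp c₀.smooth_invFun hinvV).contDiffOn
    · simp only [h, hi, if_false]
      exact (EuclideanSpace.proj i : EuclideanSpace ℝ (Fin n) →L[ℝ] ℝ).contDiff.contDiffOn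
  have hder : HasFDerivWithinAt h (fderivWithin ℝ h K 0) K 0 :=
    (hh.differentiableOn (by simp) 0 h0K).hasFDerivWithinAt
  have hder' : ∀ i, HasFDerivWithinAt (fun x => h x i)
      ((EuclideanSpace.proj i : EuclideanSpace ℝ (Fin n) →L[ℝ] ℝ).comp (fderivWithin ℝ h K 0))
      K 0 := fun i =>
    (EuclideanSpace.proj i : EuclideanSpace ℝ (Fin n) →L[ℝ] ℝ).hasFDerivAt.comp_hasFDerivWithinAt
      0 hder
  have hLA : ∀ x, ∀ i ∈ A, fderivWithin ℝ h K 0 x i = dfun n (u i) p (c.frame p x) := by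
    intro x i hi
    have h1 := (c.hasFDerivWithinAt_comp_invFun_zero (hud i hi)).mono (cornerCube_mono hδ₀ε)
    have h2 := hder' i
    simp only [h, hi, if_true] at h2
    have h3 := (uniqueDiffOn_cornerCube hδ₀ 0 h0K).eq h2 h1
    exact congrArg (fun L => L x) h3
  have hLnA : ∀ x, ∀ i ∉ A, fderivWithin ℝ h K 0 x i = x i := by
    intro x i hi
    have h1 := (EuclideanSpace.proj i : EuclideanSpace ℝ (Fin n) →L[ℝ] ℝ).hasFDerivWithinAt
      (s := K) (x := 0)
    have h2 := hder' i
    simp only [h, hi, if_false] at h2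
    have h3 := (uniqueDiffOn_cornerCube hδ₀ 0 h0K).eq h2 h1
    exact congrArg (fun L => L x) h3
  have hframe : ∀ x, c.frame p x = ∑ j, x j • c.vec j := fun x => by
    conv_lhs => rw [c.eq_sum_vec (c.frame p x)]
    simp only [c.dfun_coord_frame c.mem_source]
  -- the derivative of `h` is surjective by means of the dual family, hence injective
  have hinj : Function.Injective (fderivWithin ℝ h K 0) := by
    refine (LinearMap.injective_iff_surjective
      (f := (fderivWithin ℝ h K 0).toLinearMap)).2 fun y => ?_
    refine ⟨WithLp.toLp 2 fun j => if j ∈ A then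
      ∑ b ∈ A, y b * dfun n (fun w => c.toFun w j) p (v b) else y j, ?_⟩
    ext i
    rw [ContinuousLinearMap.coe_coe]
    by_cases hi : i ∈ A
    · have h1 : ∀ b ∈ A, ∑ j ∈ A, dfun n (fun w => c.toFun w j) p (v b) *
          dfun n (u i) p (c.vec j) = if i = b then 1 else 0 := by
        intro b hb
        rw [← hv i hi b hb]
        conv_rhs => rw [c.eq_sum_vec (v b), map_sum]
        refine Finset.sum_subset_zero_on_sdiff (Finset.subset_univ _) (fun j hj => ?_)
          fun j hj => by rw [map_smul, smul_eq_mul]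
        rw [map_smul, hray i hi j (Finset.mem_sdiff.1 hj).2, smul_zero]
      rw [hLA _ i hi, hframe, map_sum]
      calc _ = ∑ j ∈ A, (∑ b ∈ A, y b * dfun n (fun w => c.toFun w j) p (v b)) *
              dfun n (u i) p (c.vec j) := by
            refine (Finset.sum_subset_zero_on_sdiff (Finset.subset_univ _) (fun j hj => ?_)
              fun j hj => ?_).symm
            · rw [map_smul, hray i hi j (Finset.mem_sdiff.1 hj).2, smul_zero]
            · simp only [map_smul, hj, if_true, smul_eq_mul]
        _ = ∑ b ∈ A, y b * ∑ j ∈ A, dfun n (fun w => c.toFun w j) p (v b) *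
              dfun n (u i) p (c.vec j) := by
            simp only [Finset.sum_mul, Finset.mul_sum]
            rw [Finset.sum_comm]
            simp only [mul_assoc]
        _ = y i := by
            rw [Finset.sum_congr rfl fun b hb => by rw [h1 b hb]]
            simp [hi]
    · rw [hLnA _ i hi]
      simp [hi]
  have hoff : ∀ x ∈ K, ∀ i ∉ A, h x i = x i := fun x _ i hi => by simp [h, hi]
  have hfix : ∀ x ∈ K, (∀ i ∈ A, x i = 0) → h x = x := by
    intro x hx hx0
    ext i
    by_cases hi : i ∈ A
    · simp only [h, hi, if_true]
      rw [hvan _ (hinvV hx) (hinvs hx) (by rwa [hright x hx]) i hi, hx0 i hi]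
    · exact hoff x hx i hi
  obtain ⟨δ, δ', g, hδ'0, hδ'δ, hδδ₀, hinjOn, hgmaps, hgr, hgs⟩ :=
    exists_smooth_inverse_on_cornerCube hA hδ₀ hh hoff hfix hinj
  have hδ0 : 0 < δ := hδ'0.trans_le hδ'δ
  let F : M → EuclideanSpace ℝ (Fin n) := fun w =>
    WithLp.toLp 2 fun i => if i ∈ A then u i w else c.toFun w i
  have hFh : ∀ w ∈ c₀.source, F w = h (c.toFun w) := fun w hw => by
    simp only [F, h, c.left_inv hw.1]
  have hhF : ∀ x ∈ K, F (c.invFun x) = h x := fun x hx =>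
    (hFh (c.invFun x) (c₀.map_target hx)).trans (by rw [hright x hx])
  have hFs : ContMDiffOn (QModel n) 𝓘(ℝ, EuclideanSpace ℝ (Fin n)) ∞ F c₀.source :=
    (hh.contMDiffOn.comp c₀.smooth_toFun fun w hw => c₀.map_source hw).congr hFh
  have hcK : ∀ w ∈ c₀.source ∩ c.toFun ⁻¹' cornerCube ∅ δ,
      c.toFun w ∈ cornerCube c.bdry δ := fun w hw => ⟨hw.2.1, (c₀.map_source hw.1).2⟩
  have hgK : MapsTo g (cornerCube c.bdry δ') K := fun y hy => cornerCube_mono hδδ₀ (hgmaps hy)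
  let c' : AdaptedCoords n p :=
    { bdry := c.bdry
      ε := δ'
      ε_pos := hδ'0
      source := (c₀.source ∩ c.toFun ⁻¹' cornerCube ∅ δ) ∩ F ⁻¹' cornerCube ∅ δ'
      isOpen_source := (hFs.continuousOn.mono inter_subset_left).isOpen_inter_preimage
        (c₀.smooth_toFun.continuousOn.isOpen_inter_preimage c₀.isOpen_source
          isOpen_cornerCube_empty) isOpen_cornerCube_empty
      mem_source := by
        refine ⟨⟨c₀.mem_source, ?_⟩, ?_⟩
        · rw [mem_preimage, c.centered]; exact zero_mem_cornerCube hδ0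
        · rw [mem_preimage, hFh p c₀.mem_source, c.centered, hfix 0 h0K (by simp)]
          exact zero_mem_cornerCube hδ'0
      toFun := F
      invFun := fun y => c.invFun (g y)
      map_source := fun w hw => ⟨hw.2.1, fun i hi => by
        have hiA : i ∉ A := Finset.disjoint_right.1 hA hi
        have := (hcK w hw.1).2 i hi
        simpa [F, hiA] using this⟩
      map_target := fun y hy => by
        refine ⟨⟨c₀.map_target (hgK hy), ?_⟩, ?_⟩
        · rw [mem_preimage, hright _ (hgK hy)]
          exact ⟨(hgmaps hy).1, by simp⟩
        · rw [mem_preimage, hhF _ (hgK hy), hgr y hy]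
          exact ⟨hy.1, by simp⟩
      left_inv := fun w hw => by
        have h1 : h (c.toFun w) ∈ cornerCube c.bdry δ' := by
          rw [← hFh w hw.1.1]
          refine ⟨hw.2.1, fun i hi => ?_⟩
          have hiA : i ∉ A := Finset.disjoint_right.1 hA hi
          have := (hcK w hw.1).2 i hi
          simpa [F, hiA] using this
        have h2 : g (h (c.toFun w)) = c.toFun w :=
          hinjOn (hgmaps h1) (hcK w hw.1) (hgr _ h1)
        rw [hFh w hw.1.1]
        change c.invFun (g (h (c.toFun w))) = w
        rw [h2, c.left_inv hw.1.1.1]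
      right_inv := fun y hy => by rw [hhF _ (hgK hy), hgr y hy]
      smooth_toFun := hFs.mono fun w hw => hw.1.1
      smooth_invFun := c₀.smooth_invFun.comp hgs.contMDiffOn hgK
      centered := by rw [hFh p c₀.mem_source, c.centered, hfix 0 h0K (by simp)] }
  refine ⟨c', fun w hw => ⟨hδ₀V hw.1.1, hw.1.1.1⟩, rfl, fun w _ i hi => ?_, fun w _ i hi => ?_,
    fun w hw hw0 => ?_⟩
  · simp [c', F, hi]
  · simp [c', F, hi]
  -- `h` fixes the point `y'` obtained from `c w` by setting the `A`-coordinates to zero; if the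
  -- `u i` vanish at `w`, then `c w` has the same image, and `h` is injective
  · have hy := hcK w hw.1
    let y' : EuclideanSpace ℝ (Fin n) := WithLp.toLp 2 fun i => if i ∈ A then 0 else c.toFun w i
    have hy' : y' ∈ cornerCube c.bdry δ := by
      refine ⟨fun i => ?_, fun i hi => ?_⟩
      · by_cases hi : i ∈ A
        · simp [y', hi, hδ0]
        · simpa [y', hi] using hy.1 i
      · have hiA : i ∉ A := Finset.disjoint_right.1 hA hi
        simpa [y', hiA] using hy.2 i hi
    have h1 : h (c.toFun w) = h y' := by
      rw [hfix y' (cornerCube_mono hδδ₀ hy') fun i hi => by simp [y', hi], ← hFh w hw.1.1]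
      ext i
      by_cases hi : i ∈ A
      · simp [F, y', hi, hw0 i hi]
      · simp [F, y', hi]
    intro i hi
    rw [hinjOn hy hy' h1]
    simp [y', hi]

end Replace

/-! ### Retracts and p-submanifolds -/

section Retract

variable {m n : ℕ}
  {M : Type*} [TopologicalSpace M] [ChartedSpace (EuclideanQuadrant n) M]
  {N : Type*} [TopologicalSpace N] [ChartedSpace (EuclideanQuadrant m) N]

/-- The dimension count for a p-submanifold which is the range of a smooth map with a smooth left
inverse: the codimension is the number of the coordinates that vanish. -/
theorem AdaptedCoords.card_add_dim {f : N → M} {g : M → N}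
    (hf : ContMDiff (QModel m) (QModel n) ∞ f) (hg : ContMDiff (QModel n) (QModel m) ∞ g)
    (hgf : ∀ w, g (f w) = w) {r : N} (c : AdaptedCoords n (f r)) {A : Finset (Fin n)}
    (hA : ∀ w ∈ c.source, w ∈ range f ↔ ∀ i ∈ A, c.toFun w i = 0) : A.card + m = n := by
  have hfd : ∀ w, MDifferentiableAt (QModel m) (QModel n) f w := fun w =>
    (hf w).mdifferentiableAt (by simp)
  have hgd : ∀ w, MDifferentiableAt (QModel n) (QModel m) g w := fun w =>
    (hg w).mdifferentiableAt (by simp)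
  have hcd := c.mdifferentiableAt_coord c.mem_source
  have hgf' : ∀ v, dmap n m g (f r) (dmap m n f r v) = v := fun v => by
    have h1 := dmap_comp (hgd (f r)) (hfd r)
    rw [show g ∘ f = id from funext hgf, dmap_id] at h1
    exact (congrArg (fun L => L v) h1).symm
  have hzero : ∀ i ∈ A, ∀ v, dfun n (fun w => c.toFun w i) (f r) (dmap m n f r v) = 0 := by
    intro i hi v
    have h1 : dfun m (fun w => c.toFun (f w) i) r = 0 := by
      refine dfun_eq_zero_of_eventually ?_
      filter_upwards [hf.continuous.continuousAt (c.source_mem_nhds c.mem_source)] with w hw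
      exact (hA (f w) hw).1 ⟨w, rfl⟩ i hi
    rw [dfun_comp (g := fun w => c.toFun w i) (hcd i) (hfd r)] at h1
    exact congrArg (fun L => L v) h1
  -- the other coordinate vectors are tangent to the submanifold
  have hvec : ∀ i ∉ A, dmap m n f r (dmap n m g (f r) (c.vec i)) = c.vec i := by
    intro i hi
    refine c.eq_of_dfun_coord_eq fun j => ?_
    have hcd' : MDifferentiableAt (QModel n) 𝓘(ℝ, ℝ) (fun w => c.toFun w j)
        ((f ∘ g) (f r)) := by
      simpa only [Function.comp_apply, hgf] using hcd j
    have hfg : MDifferentiableAt (QModel n) (QModel n) (f ∘ g) (f r) :=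
      (hfd _).comp _ (hgd _)
    have hcomp : MDifferentiableAt (QModel n) 𝓘(ℝ, ℝ) (fun w => c.toFun ((f ∘ g) w) j) (f r) :=
      hcd'.comp (f r) hfg
    have h1 : dfun n (fun w => c.toFun ((f ∘ g) w) j - c.toFun w j) (f r) (c.vec i) = 0 := by
      refine c.dfun_vec_eq_zero_of_ray (hcomp.sub (hcd j))
        (by simp [hgf]) ?_
      filter_upwards [eventually_smul_single_mem_cornerCube (B := c.bdry) c.ε_pos i] with s hs
      obtain ⟨x, hx⟩ := (hA _ (c.map_target hs)).2 fun l hl => by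
        have : l ≠ i := fun h => hi (h ▸ hl)
        rw [c.right_inv hs]
        simp [this]
      rw [← hx, Function.comp_apply, hgf, sub_self]
    rw [dfun_sub hcomp (hcd j), sub_apply, sub_eq_zero,
      dfun_comp (g := fun w => c.toFun w j) hcd' hfg, dmap_comp (hfd _) (hgd _)] at h1
    simp only [Function.comp_apply, hgf, ContinuousLinearMap.comp_apply] at h1
    exact h1
  let φ : EuclideanSpace ℝ (Fin m) →ₗ[ℝ] ({i : Fin n // i ∉ A} → ℝ) :=
    LinearMap.pi fun i =>
      ((dfun n (fun w => c.toFun w i) (f r)).comp (dmap m n f r)).toLinearMap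
  have hφ : Function.Bijective φ := by
    constructor
    · refine (injective_iff_map_eq_zero φ).2 fun v hv => ?_
      have h1 : dmap m n f r v = 0 := by
        refine c.eq_of_dfun_coord_eq fun i => ?_
        rw [map_zero]
        by_cases hi : i ∈ A
        · exact hzero i hi v
        · exact congrFun hv ⟨i, hi⟩
      rw [← hgf' v, h1, map_zero]
    · intro y
      refine ⟨dmap n m g (f r) (∑ i : {i : Fin n // i ∉ A}, y i • c.vec i), ?_⟩
      ext j
      change dfun n (fun w => c.toFun w j) (f r) (dmap m n f r _) = y j
      have hvec' : ∀ i : {i : Fin n // i ∉ A},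
          dmap m n f r (dmap n m g (f r) (c.vec i)) = c.vec i := fun i => hvec i i.2
      simp only [map_sum, map_smul, hvec', c.dfun_coord_vec, smul_eq_mul,
        mul_ite, mul_one, mul_zero, ← Subtype.ext_iff]
      simp
  have h1 := (LinearEquiv.ofBijective φ hφ).finrank_eq
  rw [finrank_euclideanSpace_fin, Module.finrank_pi, Fintype.card_subtype_compl,
    Fintype.card_fin, Fintype.card_coe] at h1
  have h2 : A.card ≤ n := by simpa using A.card_le_univ
  omega

/-- A subset cut out by coordinates which contains the range of an interior b-map is cut out by
interior coordinates only: the map takes interior points to interior points. -/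
theorem AdaptedCoords.disjoint_bdry_of_isInteriorBMap {f : N → M} (hf : IsInteriorBMap m n f)
    {r : N} (c : AdaptedCoords n (f r)) {A : Finset (Fin n)}
    (hA : ∀ w ∈ c.source, w ∈ range f → ∀ i ∈ A, c.toFun w i = 0) : Disjoint A c.bdry := by
  refine Finset.disjoint_left.2 fun i hiA hib => ?_
  obtain ⟨c₁, c', hmaps, hprod⟩ := hf.2 r
  obtain ⟨δ, h0, hδ, hsub⟩ := c₁.exists_shrink_subset
    (hf.1.continuous.continuousAt (c.source_mem_nhds c.mem_source))
  -- an interior point close to `r`; at its image `c i` would attain the minimum `0` at an interior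
  -- point, and its differential would vanish there
  let x : EuclideanSpace ℝ (Fin m) := WithLp.toLp 2 fun _ => δ / 2
  have hx : x ∈ cornerCube c₁.bdry δ :=
    ⟨fun j => by simp only [x, abs_of_pos (half_pos h0)]; linarith, fun j _ => (half_pos h0).le⟩
  have hw : c₁.invFun x ∈ (c₁.shrink h0 hδ).source := (c₁.shrink h0 hδ).map_target hx
  have hcx : c₁.toFun (c₁.invFun x) = x := (c₁.shrink h0 hδ).right_inv hx
  set w := c₁.invFun x
  have hfw : f w ∈ c.source := hsub hw
  have hpos : ∀ j ∈ c'.bdry, 0 < c'.toFun (f w) j := by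
    intro j hj
    obtain ⟨a, α, -, hα, h⟩ := hprod j hj
    rw [h w hw.1]
    refine mul_pos (hα w hw.1) (Finset.prod_pos fun l _ => pow_pos ?_ _)
    rw [hcx]
    exact half_pos h0
  have h1 : dfun n (fun w => c.toFun w i) (f w) = 0 := by
    refine c'.dfun_eq_zero_of_nonneg_of_pos (hmaps hw.1) hpos (c.mdifferentiableAt_coord hfw i)
      (hA _ hfw ⟨w, rfl⟩ i hiA) ?_
    filter_upwards [c.source_mem_nhds hfw] with y hy
    exact (c.map_source hy).2 i hib
  have h2 := c.dfun_coord_frame hfw i (EuclideanSpace.single i 1)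
  simp [h1] at h2

/-- The differential of a b-fibration reaches all the interior coordinate vectors, in any adapted
coordinates. -/
theorem IsBFibration.vec_mem_range {f : N → M} (hf : IsBFibration m n f) (p : N)
    (c : AdaptedCoords n (f p)) {i : Fin n} (hi : i ∉ c.bdry) :
    ∃ v, dmap m n f p v = c.vec i := by
  obtain ⟨c₁, c', hmaps, ⟨σ, hσ⟩, -⟩ := hf.2.2 p
  have hfd : MDifferentiableAt (QModel m) (QModel n) f p :=
    (hf.1.1 p).mdifferentiableAt (by simp)
  have hc'0 : ∀ l, c'.toFun (f p) l = 0 := fun l => by rw [c'.centered]; rfl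
  have hnonneg : ∀ j ∈ c'.bdry, ∀ᶠ w in 𝓝 (f p), 0 ≤ c'.toFun w j := fun j hj => by
    filter_upwards [c'.source_mem_nhds c'.mem_source] with w hw
    exact (c'.map_source hw).2 j hj
  -- the interior coordinate vectors for the coordinates adapted to the b-fibration are reached
  have hvec : ∀ l : {l : Fin n // l ∉ c'.bdry}, dmap m n f p (c₁.vec (σ l)) = c'.vec l := by
    intro l
    refine c'.eq_of_dfun_coord_eq fun j => ?_
    have hcomp := dfun_comp (g := fun w => c'.toFun w j)
      (c'.mdifferentiableAt_coord c'.mem_source j) hfd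
    rw [c'.dfun_coord_vec]
    change ((dfun n (fun w => c'.toFun w j) (f p)).comp (dmap m n f p)) _ = _
    rw [← hcomp]
    by_cases hj : j ∈ c'.bdry
    · rw [if_neg fun h : j = (l : Fin n) => l.2 (h ▸ hj)]
      exact c₁.dfun_vec_eq_zero_of_nonneg (σ l).2
        ((c'.mdifferentiableAt_coord c'.mem_source j).comp p hfd) (hc'0 j)
        (hf.1.1.continuous.continuousAt.eventually (hnonneg j hj))
    · have h1 : (fun w => c'.toFun (f w) j) =ᶠ[𝓝 p] fun w => c₁.toFun w (σ ⟨j, hj⟩) := by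
        filter_upwards [c₁.source_mem_nhds c₁.mem_source] with w hw
        exact hσ ⟨j, hj⟩ w hw
      rw [dfun_eq_of_eventuallyEq h1, c₁.dfun_coord_vec]
      simp only [← Subtype.ext_iff, σ.injective.eq_iff]
      congr 1
      simp [Subtype.ext_iff]
  -- the interior coordinate vectors for any adapted coordinates have the same span
  refine ⟨∑ l : {l : Fin n // l ∉ c'.bdry},
    dfun n (fun w => c'.toFun w l) (f p) (c.vec i) • c₁.vec (σ l), ?_⟩
  rw [map_sum]
  simp only [map_smul, hvec]
  conv_rhs => rw [c'.eq_sum_vec (c.vec i)]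
  rw [← Finset.sum_subtype (Finset.univ.filter fun l => l ∉ c'.bdry) (by simp)
    (fun l => dfun n (fun w => c'.toFun w l) (f p) (c.vec i) • c'.vec l)]
  refine Finset.sum_subset (Finset.subset_univ _) fun l _ hl => ?_
  have hl' : l ∈ c'.bdry := by simpa using hl
  rw [c.dfun_vec_eq_zero_of_nonneg hi (c'.mdifferentiableAt_coord c'.mem_source l) (hc'0 l)
    (hnonneg l hl'), zero_smul]

end Retract

namespace GeneralizedProduct

variable (G : GeneralizedProduct)

/-! ### The combinatorics of the multidiagonals -/

section Combinatorics

variable {k : ℕ}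

theorem S_S {l m n : ℕ} (I : Fin (m + 1) → Fin (l + 1)) (K : Fin (n + 1) → Fin (m + 1))
    (q : G.obj l) : G.S K (G.S I q) = G.S (I ∘ K) q := by
  rw [G.S_comp]; rfl

theorem S_id_apply (q : G.obj k) : G.S (id : Fin (k + 1) → Fin (k + 1)) q = q := by
  rw [G.S_id]; rfl

/-- The elements `i` and `j` are related if the structure map of the map which moves `i` to `j`
fixes `q`. This is the coarsest partition whose multidiagonal contains `q`. -/
def coarsest (q : G.obj k) : Setoid (Fin (k + 1)) where
  r i j := G.S (Function.update id i j) q = q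
  iseqv := by
    -- if `e` and `e ∘ f` agree and `e` fixes `q`, so does `f`
    have key : ∀ e f : Fin (k + 1) → Fin (k + 1), e ∘ f = e → G.S e q = q → G.S f q = q := by
      intro e f hef he
      conv_lhs => rw [← he]
      rw [G.S_S, hef, he]
    refine ⟨fun i => by simp [Function.update_eq_self_iff.2, S_id_apply], ?_, ?_⟩
    · intro i j h
      refine key _ _ ?_ h
      ext x
      grind [Function.update_apply]
    · intro i j l hij hjl
      refine key (Function.update id j l ∘ Function.update id i j) _ ?_ ?_
      · ext x
        grind [Function.update_apply]
      · rw [← G.S_S, hjl, hij]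

theorem exists_surjective_ker (𝔓 : Setoid (Fin (k + 1))) :
    ∃ (m : ℕ) (I : Fin (k + 1) → Fin (m + 1)), Function.Surjective I ∧ Setoid.ker I = 𝔓 := by
  classical
  obtain ⟨m, hm⟩ := Nat.exists_eq_succ_of_ne_zero
    (Fintype.card_ne_zero (α := Quotient 𝔓))
  let e : Quotient 𝔓 ≃ Fin (m + 1) := Fintype.equivFinOfCardEq hm
  refine ⟨m, e ∘ Quotient.mk 𝔓, e.surjective.comp Quotient.mk_surjective, ?_⟩
  ext i j
  change e _ = e _ ↔ _
  rw [e.injective.eq_iff]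
  exact Quotient.eq

theorem S_eq_self_of_idempotent {q : G.obj k} {e : Fin (k + 1) → Fin (k + 1)}
    (he : ∀ i, e (e i) = e i) (h : ∀ i, G.coarsest q i (e i)) : G.S e q = q := by
  have key : ∀ T : Finset (Fin (k + 1)), G.S (fun i => if i ∈ T then e i else i) q = q := by
    intro T
    induction T using Finset.induction_on with
    | empty => simpa using! G.S_id_apply q
    | insert a T _ ih =>
      have : (fun i => if i ∈ insert a T then e i else i) =
          (fun i => if i ∈ T then e i else i) ∘ Function.update id a (e a) := by
        funext i
        by_cases hi : i = a
        · subst hi; simp [he]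
        · simp [hi]
      rw [this, ← G.S_S, ih]
      exact h a
  simpa using key Finset.univ

theorem mem_diagonal_iff {𝔓 : Setoid (Fin (k + 1))} {q : G.obj k} :
    q ∈ G.diagonal 𝔓 ↔ 𝔓 ≤ G.coarsest q := by
  constructor
  · rintro ⟨m, I, -, rfl, r, rfl⟩ i j hij
    change G.S _ (G.S I r) = G.S I r
    rw [G.S_S]
    congr 1
    ext x
    have : I i = I j := hij
    by_cases hx : x = i
    · subst hx; simp [this]
    · simp [hx]
  · intro h
    obtain ⟨m, I, hI, rfl⟩ := exists_surjective_ker 𝔓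
    refine ⟨m, I, hI, rfl, G.S (Function.surjInv hI) q, ?_⟩
    rw [G.S_S]
    refine G.S_eq_self_of_idempotent (fun i => ?_) fun i => h ?_
    · simp [Function.surjInv_eq]
    · exact (Function.surjInv_eq hI (I i)).symm

theorem diagonal_inter (𝔓 𝔔 : Setoid (Fin (k + 1))) :
    G.diagonal 𝔓 ∩ G.diagonal 𝔔 = G.diagonal (𝔓 ⊔ 𝔔) := by
  ext q
  simp only [mem_inter_iff, mem_diagonal_iff, sup_le_iff]

theorem diagonal_anti {𝔓 𝔔 : Setoid (Fin (k + 1))} (h : 𝔔 ≤ 𝔓) :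
    G.diagonal 𝔓 ⊆ G.diagonal 𝔔 := fun _ hq =>
  G.mem_diagonal_iff.2 (h.trans (G.mem_diagonal_iff.1 hq))

theorem S_eq_of_mem_diagonal {n : ℕ} {𝔓 : Setoid (Fin (k + 1))} {q : G.obj k}
    (hq : q ∈ G.diagonal 𝔓) {K K' : Fin (n + 1) → Fin (k + 1)} (h : ∀ a, 𝔓 (K a) (K' a)) :
    G.S K q = G.S K' q := by
  obtain ⟨m, I, -, rfl, r, rfl⟩ := hq
  rw [G.S_S, G.S_S]
  congr 1
  ext a
  exact congrArg _ (h a)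

instance finite_setoid : Finite (Setoid (Fin (k + 1))) :=
  Finite.of_injective (fun s : Setoid (Fin (k + 1)) => fun i j => s i j) fun _ _ hss =>
    Setoid.ext fun i j => iff_of_eq (congrFun (congrFun hss i) j)

theorem singlePart_sup {P Q : Finset (Fin (k + 1))} (h : (P ∩ Q).Nonempty) :
    singlePart P ⊔ singlePart Q = singlePart (P ∪ Q) := by
  obtain ⟨x, hx⟩ := h
  rw [Finset.mem_inter] at hx
  refine le_antisymm (sup_le ?_ ?_) ?_
  · rintro a b (rfl | ⟨ha, hb⟩)
    · exact Or.inl rfl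
    · exact Or.inr ⟨Finset.mem_union_left _ ha, Finset.mem_union_left _ hb⟩
  · rintro a b (rfl | ⟨ha, hb⟩)
    · exact Or.inl rfl
    · exact Or.inr ⟨Finset.mem_union_right _ ha, Finset.mem_union_right _ hb⟩
  · have key : ∀ a ∈ P ∪ Q, (singlePart P ⊔ singlePart Q) a x := by
      intro a ha
      rcases Finset.mem_union.1 ha with ha | ha
      · exact (le_sup_left : singlePart P ≤ singlePart P ⊔ singlePart Q) (Or.inr ⟨ha, hx.1⟩)
      · exact (le_sup_right : singlePart Q ≤ singlePart P ⊔ singlePart Q) (Or.inr ⟨ha, hx.2⟩)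
    rintro a b (rfl | ⟨ha, hb⟩)
    · exact Setoid.refl' _ _
    · exact Setoid.trans' _ (key a ha) (Setoid.symm' _ (key b hb))

end Combinatorics

/-! ### The reflection of `M[2]` -/

section Reflection

theorem contMDiff_S {m n : ℕ} (I : Fin (n + 1) → Fin (m + 1)) :
    ContMDiff (QModel (G.dim m)) (QModel (G.dim n)) ∞ (G.S I) := (G.interiorBMap I).1

theorem continuous_S {m n : ℕ} (I : Fin (n + 1) → Fin (m + 1)) : Continuous (G.S I) :=
  (G.contMDiff_S I).continuous

theorem mdifferentiableAt_S {m n : ℕ} (I : Fin (n + 1) → Fin (m + 1)) (q : G.obj m) :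
    MDifferentiableAt (QModel (G.dim m)) (QModel (G.dim n)) (G.S I) q :=
  (G.contMDiff_S I q).mdifferentiableAt (by simp)

/-- The differential of a structure map. -/
noncomputable def dS {m n : ℕ} (I : Fin (n + 1) → Fin (m + 1)) (q : G.obj m) :
    EuclideanSpace ℝ (Fin (G.dim m)) →L[ℝ] EuclideanSpace ℝ (Fin (G.dim n)) :=
  dmap (G.dim m) (G.dim n) (G.S I) q

theorem dS_dS {l m n : ℕ} (I : Fin (m + 1) → Fin (l + 1)) (K : Fin (n + 1) → Fin (m + 1))
    {J : Fin (n + 1) → Fin (l + 1)} (hJ : I ∘ K = J) (q : G.obj l) {q' : G.obj m}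
    (hq : G.S I q = q') (v : EuclideanSpace ℝ (Fin (G.dim l))) :
    G.dS K q' (G.dS I q v) = G.dS J q v := by
  subst hq hJ
  rw [dS, dS, dS, G.S_comp, dmap_comp (G.mdifferentiableAt_S K _) (G.mdifferentiableAt_S I q)]
  rfl

theorem dS_id {k : ℕ} (q : G.obj k) (v : EuclideanSpace ℝ (Fin (G.dim k))) :
    G.dS (id : Fin (k + 1) → Fin (k + 1)) q v = v := by
  rw [dS, G.S_id, dmap_id]; rfl

/-- The reflection acts as `-1` on the normal space of the diagonal. In the tangent space of `M[3]`
at a point of the small diagonal, the tangent spaces of two of the diagonals, which are copies of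
the tangent space of `M[2]`, span for reasons of dimension. A vector tangent to the third diagonal
is the sum of vectors tangent to the first two; application of the differentials of the three
projections to `M[2]` gives the claim. -/
theorem exists_dS_swap_add (r : G.obj 0) (v : EuclideanSpace ℝ (Fin (G.dim 1))) :
    ∃ a, G.dS (![1, 0] : Fin 2 → Fin 2) (G.S (fun _ : Fin 2 => (0 : Fin 1)) r) v + v =
      G.dS (fun _ : Fin 2 => (0 : Fin 1)) r a := by
  set d := G.S (m := 0) (n := 1) (fun _ => 0) r with hd
  set o := G.S (m := 0) (n := 2) (fun _ => 0) r with ho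
  have hdo : ∀ s : Fin 3 → Fin 2, G.S (m := 1) (n := 2) s d = o := fun s => by
    rw [hd, G.S_S]; rfl
  have hdr : ∀ p : Fin 1 → Fin 2, G.S (m := 1) (n := 0) p d = r := fun p => by
    rw [hd, G.S_S]
    conv_rhs => rw [← G.S_id_apply r]
    congr 1
    ext x; omega
  let u := G.dS (m := 0) (n := 1) (fun _ => 0) r
  let t := G.dS (m := 0) (n := 2) (fun _ => 0) r
  -- composites of a degeneracy and a projection which are constant factor through `M[1]`
  have hconst : ∀ (s : Fin 3 → Fin 2) (p : Fin 2 → Fin 3) (i : Fin 2), (∀ x, s (p x) = i) →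
      ∀ v, ∃ a, G.dS (m := 2) (n := 1) p o (G.dS (m := 1) (n := 2) s d v) = u a := by
    intro s p i hsp v
    refine ⟨G.dS (m := 1) (n := 0) (fun _ => i) d v, ?_⟩
    rw [G.dS_dS s p rfl d (hdo s), G.dS_dS (fun _ => i) (fun _ => 0) rfl d (hdr _)]
    congr 2
    ext x
    simp [hsp]
  have hident : ∀ (s : Fin 3 → Fin 2) (p : Fin 2 → Fin 3), s ∘ p = id →
      ∀ v, G.dS (m := 2) (n := 1) p o (G.dS (m := 1) (n := 2) s d v) = v := by
    intro s p hsp v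
    rw [G.dS_dS s p hsp d (hdo s), G.dS_id]
  have hut : ∀ (s : Fin 3 → Fin 2) a, G.dS (m := 1) (n := 2) s d (u a) = t a := fun s a =>
    G.dS_dS _ _ rfl r rfl a
  have ht : ∀ a, t a = 0 → a = 0 := by
    intro a ha
    have h1 := G.dS_dS (l := 0) (m := 2) (n := 0) (fun _ => 0) (fun _ => 0) (J := id)
      (by ext x; omega) r rfl a
    rw [G.dS_id] at h1
    rw [← h1]
    change G.dS _ _ (t a) = 0
    rw [ha, map_zero]
  let Ψ : (EuclideanSpace ℝ (Fin (G.dim 1)) × EuclideanSpace ℝ (Fin (G.dim 1))) →ₗ[ℝ]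
      EuclideanSpace ℝ (Fin (G.dim 2)) :=
    (G.dS (m := 1) (n := 2) ![0, 1, 0] d).toLinearMap.coprod
      (G.dS (m := 1) (n := 2) ![0, 0, 1] d).toLinearMap
  -- the two diagonals meet in the small diagonal, so the kernel has at most the dimension of `M[1]`
  have hker : LinearMap.ker Ψ ≤ LinearMap.range (u.toLinearMap.prod (-u.toLinearMap)) := by
    rintro ⟨x, y⟩ hxy
    have hxy : G.dS (m := 1) (n := 2) ![0, 1, 0] d x +
      G.dS (m := 1) (n := 2) ![0, 0, 1] d y = 0 := hxy
    obtain ⟨a, ha⟩ := hconst ![0, 0, 1] ![0, 1] 0 (by decide) y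
    obtain ⟨b, hb⟩ := hconst ![0, 1, 0] ![0, 2] 0 (by decide) x
    have h1 := congrArg (G.dS (m := 2) (n := 1) ![0, 1] o) hxy
    rw [map_add, map_zero, ha, hident _ _ (by decide)] at h1
    have h2 := congrArg (G.dS (m := 2) (n := 1) ![0, 2] o) hxy
    rw [map_add, map_zero, hb, hident _ _ (by decide)] at h2
    have hx : x = u (-a) := by rw [map_neg]; exact eq_neg_of_add_eq_zero_left h1
    have hy : y = u (-b) := by rw [map_neg]; exact eq_neg_of_add_eq_zero_right h2
    rw [hx, hy, hut, hut, ← map_add] at hxy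
    have h3 : -b = - -a := eq_neg_of_add_eq_zero_right (ht _ hxy)
    refine ⟨-a, ?_⟩
    rw [hx, hy, h3]
    ext1
    · rfl
    · simp
  have hrank : LinearMap.range Ψ = ⊤ := by
    refine Submodule.eq_top_of_finrank_eq (le_antisymm (Submodule.finrank_le _) ?_)
    have h1 := LinearMap.finrank_range_add_finrank_ker Ψ
    have h2 := (Submodule.finrank_mono hker).trans (LinearMap.finrank_range_le _)
    rw [Module.finrank_prod, finrank_euclideanSpace_fin] at h1
    rw [finrank_euclideanSpace_fin] at h2 ⊢
    simp only [dim] at h1 h2 ⊢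
    omega
  obtain ⟨⟨x, y⟩, hxy⟩ : G.dS (m := 1) (n := 2) ![0, 1, 1] d v ∈ LinearMap.range Ψ :=
    hrank ▸ Submodule.mem_top
  have hxy : G.dS (m := 1) (n := 2) ![0, 1, 0] d x +
      G.dS (m := 1) (n := 2) ![0, 0, 1] d y = G.dS (m := 1) (n := 2) ![0, 1, 1] d v := hxy
  obtain ⟨a, ha⟩ := hconst ![0, 0, 1] ![0, 1] 0 (by decide) y
  obtain ⟨b, hb⟩ := hconst ![0, 1, 0] ![0, 2] 0 (by decide) x
  obtain ⟨e, he⟩ := hconst ![0, 1, 1] ![1, 2] 1 (by decide) v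
  have h1 := congrArg (G.dS (m := 2) (n := 1) ![0, 1] o) hxy
  rw [map_add, ha, hident _ _ (by decide), hident _ _ (by decide)] at h1
  have h2 := congrArg (G.dS (m := 2) (n := 1) ![0, 2] o) hxy
  rw [map_add, hb, hident _ _ (by decide), hident _ _ (by decide)] at h2
  have h3 := congrArg (G.dS (m := 2) (n := 1) ![1, 2] o) hxy
  rw [map_add, he, hident ![0, 0, 1] ![1, 2] (by decide),
    G.dS_dS ![0, 1, 0] ![1, 2] (J := ![1, 0]) (by decide) d (hdo _)] at h3
  have hR : ∀ a, G.dS (m := 1) (n := 1) ![1, 0] d (u a) = u a := fun a =>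
    G.dS_dS _ _ rfl r rfl a
  have hx : x = v - u a := eq_sub_of_add_eq h1
  have hy : y = v - u b := eq_sub_of_add_eq' h2
  refine ⟨e + a + b, ?_⟩
  change _ = u _
  rw [hx, hy, map_sub, hR] at h3
  rw [map_add, map_add, ← h3]
  abel

theorem R_R (w : G.obj 1) : G.R (G.R w) = w := by
  rw [R, G.S_S]
  conv_rhs => rw [← G.S_id_apply w]
  congr 1
  ext x
  fin_cases x <;> rfl

theorem R_eq_self {w : G.obj 1} (hw : w ∈ G.D) : G.R w = w := by
  obtain ⟨r, rfl⟩ := hw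
  rw [R, G.S_S]; rfl

/-- Odd defining functions of the diagonal: the differences `y - y ∘ R` for defining coordinates
`y` of the diagonal. Since the reflection acts as `-1` on the normal space, their differentials are
twice those of the `y`. -/
theorem exists_isOddDefining {d : G.obj 1} (hd : d ∈ G.D) : ∃ z, G.IsOddDefining d z := by
  obtain ⟨r, rfl⟩ := hd
  have hsurj : Function.Surjective (fun _ : Fin 2 => (0 : Fin 1)) := fun x => ⟨0, by omega⟩
  set d := G.S (m := 0) (n := 1) (fun _ => 0) r with hd
  have hdD : d ∈ G.D := ⟨r, rfl⟩
  obtain ⟨c, A, hA⟩ := (G.pEmbedding (m := 0) (n := 1) _ hsurj).2.1.2.2 d ⟨r, rfl⟩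
  have hcard := c.card_add_dim (G.contMDiff_S (m := 0) (n := 1) fun _ => 0)
    (G.contMDiff_S (m := 1) (n := 0) fun _ => 0) (fun w => by
      rw [G.S_S]
      conv_rhs => rw [← G.S_id_apply w]
      congr 1
      ext x; omega) hA
  have hcard : A.card = G.κ := by simp only [dim] at hcard; omega
  have hdisj := c.disjoint_bdry_of_isInteriorBMap (G.interiorBMap (m := 0) (n := 1) fun _ => 0)
    fun w hw hwr => (hA w hw).1 hwr
  have hRd : G.R d = d := G.R_eq_self hdD
  have hRs : ContMDiff (QModel (G.dim 1)) (QModel (G.dim 1)) ∞ G.R := G.contMDiff_S _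
  let u : Fin (G.dim 1) → G.obj 1 → ℝ := fun i w => c.toFun w i - c.toFun (G.R w) i
  have hcd := c.mdifferentiableAt_coord c.mem_source
  have hu0 : ∀ w ∈ c.source, (∀ i ∈ A, c.toFun w i = 0) → ∀ i ∈ A, u i w = 0 := by
    intro w hw h0 i _
    simp only [u, G.R_eq_self ((hA w hw).2 h0), sub_self]
  obtain ⟨c', hsub, hb, hcu, -, hc'⟩ := c.exists_replace hdisj (u := u)
    (V := c.source ∩ G.R ⁻¹' c.source)
    (inter_mem (c.source_mem_nhds c.mem_source) (hRs.continuous.continuousAt.preimage_mem_nhds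
      (c.source_mem_nhds (hRd.symm ▸ c.mem_source))))
    (fun i _ => ((c.contMDiffOn_coord i).mono inter_subset_left).sub
      (((c.contMDiffOn_coord i).comp hRs.contMDiffOn fun w hw => hw.2).mono subset_rfl))
    (fun w _ hw => hu0 w hw) (v := fun j => (1 / 2 : ℝ) • c.vec j) (by
      intro i hi j hj
      have hcd' : MDifferentiableAt (QModel (G.dim 1)) 𝓘(ℝ, ℝ) (fun w => c.toFun w i) (G.R d) :=
        hRd.symm ▸ hcd i
      have hRd' := hRs.mdifferentiableAt (by simp) (x := d)
      obtain ⟨a, ha⟩ := G.exists_dS_swap_add r (c.vec j)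
      have h0 : dfun (G.dim 1) (fun w => c.toFun w i) d
          (G.dS (m := 0) (n := 1) (fun _ => 0) r a) = 0 := by
        have h1 : dfun (G.dim 0) (fun w => c.toFun (G.S (m := 0) (n := 1) (fun _ => 0) w) i) r
            = 0 := by
          refine dfun_eq_zero_of_eventually ?_
          filter_upwards [(G.continuous_S (m := 0) (n := 1) fun _ => 0).continuousAt
            (c.source_mem_nhds c.mem_source)] with w hw
          exact (hA _ hw).1 ⟨w, rfl⟩ i hi
        rw [dfun_comp (g := fun w => c.toFun w i) (hcd i) (G.mdifferentiableAt_S _ _)] at h1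
        exact congrArg (fun L => L a) h1
      have h2 : G.dS (![1, 0] : Fin 2 → Fin 2) d (c.vec j) =
          G.dS (m := 0) (n := 1) (fun _ => 0) r a - c.vec j := eq_sub_of_add_eq ha
      have h3 : dmap (G.dim 1) (G.dim 1) G.R d (c.vec j) =
          G.dS (m := 0) (n := 1) (fun _ => 0) r a - c.vec j := h2
      have hcR : MDifferentiableAt (QModel (G.dim 1)) 𝓘(ℝ, ℝ) (fun w => c.toFun (G.R w) i) d :=
        hcd'.comp d hRd'
      have h4 : dfun (G.dim 1) (u i) d (c.vec j) = 2 * if i = j then 1 else 0 := by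
        simp only [u]
        rw [dfun_sub (hcd i) hcR, sub_apply, c.dfun_coord_vec,
          dfun_comp (g := fun w => c.toFun w i) hcd' hRd', ContinuousLinearMap.comp_apply, h3,
          hRd, map_sub, h0, c.dfun_coord_vec]
        ring
      rw [map_smul, h4, smul_eq_mul]
      ring)
  let e : Fin G.κ ≃ A := (Fintype.equivFinOfCardEq (by rw [Fintype.card_coe, hcard])).symm
  refine ⟨fun w t => u (e t) w, ⟨c', ⟨⟨fun t => ⟨e t, ?_⟩, ?_⟩, ?_⟩⟩, ?_, ?_⟩
  · rw [hb]
    exact Finset.disjoint_left.1 hdisj (e t).2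
  · intro t t' h
    exact e.injective (Subtype.ext (Subtype.mk.inj h))
  · exact fun t w hw => hcu w hw _ (e t).2
  · refine Eventually.of_forall fun w => ?_
    ext t
    simp only [u, G.R_R, Pi.neg_apply, neg_sub]
  · filter_upwards [c'.source_mem_nhds c'.mem_source] with w hw
    have hwc := (hsub hw).2
    refine ⟨fun hwD => ?_, fun h0 => (hA w hwc).2 (hc' w hw fun i hi => ?_)⟩
    · ext t
      exact hu0 w hwc ((hA w hwc).1 hwD) _ (e t).2
    · have := congrFun h0 (e.symm ⟨i, hi⟩)
      simpa using this

end Reflection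

/-! ### Local equations of the multidiagonals -/

section LocalEquations

variable {k : ℕ}

/-- Functions with independent differentials which vanish on a multidiagonal define it and are
interior coordinates near `q`, if there are `κ` of them for each element which is not the
representative of its part: the dimension leaves no room for further equations. -/
theorem exists_coords_of_defining {𝔔 : Setoid (Fin (k + 1))} {q : G.obj k}
    (hq : q ∈ G.diagonal 𝔔) {b : Fin (k + 1) → Fin (k + 1)} (hb : ∀ j, 𝔔 j (b j))
    (hb' : ∀ i j, 𝔔 i j → b i = b j) {u : {j : Fin (k + 1) // b j ≠ j} × Fin G.κ → G.obj k → ℝ}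
    {V : Set (G.obj k)} (hV : V ∈ 𝓝 q)
    (hu : ∀ a, ContMDiffOn (QModel (G.dim k)) 𝓘(ℝ, ℝ) ∞ (u a) V)
    (hvan : ∀ w ∈ V, w ∈ G.diagonal 𝔔 → ∀ a, u a w = 0)
    {v : {j : Fin (k + 1) // b j ≠ j} × Fin G.κ → EuclideanSpace ℝ (Fin (G.dim k))}
    (hv : ∀ a a', dfun (G.dim k) (u a) q (v a') = if a = a' then 1 else 0) :
    ∃ c : AdaptedCoords (G.dim k) q, c.source ⊆ V ∧ c.IncludesInterior u ∧
      ∀ w ∈ c.source, w ∈ G.diagonal 𝔔 ↔ ∀ a, u a w = 0 := by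
  obtain ⟨m, I, hI, rfl, r, rfl⟩ := hq
  rw [G.diagonal_eq_range I hI] at hvan ⊢
  obtain ⟨c, A, hA⟩ := (G.pEmbedding I hI).2.1.2.2 _ ⟨r, rfl⟩
  have hcard := c.card_add_dim (G.contMDiff_S I) (G.contMDiff_S (Function.surjInv hI))
    (fun w => by
      rw [G.S_S]
      conv_rhs => rw [← G.S_id_apply w]
      congr 1
      ext x
      simp [Function.surjInv_eq]) hA
  have hdisj := c.disjoint_bdry_of_isInteriorBMap (G.interiorBMap I)
    fun w hw hwr => (hA w hw).1 hwr
  -- the representatives correspond to the parts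
  have hrep : Fintype.card {j : Fin (k + 1) // b j = j} = m + 1 := by
    rw [← Fintype.card_fin (m + 1)]
    refine Fintype.card_of_bijective (f := fun j : {j : Fin (k + 1) // b j = j} => I j)
      ⟨fun i j hij => ?_, fun x => ?_⟩
    · have := hb' i j hij
      rw [i.2, j.2] at this
      exact Subtype.ext this
    · obtain ⟨j, rfl⟩ := hI x
      exact ⟨⟨b j, (hb' _ _ (hb j)).symm⟩, (hb j).symm⟩
  have hcard' : Fintype.card ({j : Fin (k + 1) // b j ≠ j} × Fin G.κ) = Fintype.card A := by
    have h1 := Fintype.card_subtype_compl fun j : Fin (k + 1) => b j = j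
    have h2 := Fintype.card_subtype_le fun j : Fin (k + 1) => b j = j
    rw [hrep, Fintype.card_fin] at h1 h2
    have h3 : Fintype.card {j : Fin (k + 1) // b j ≠ j} + m = k := by
      change Fintype.card {j : Fin (k + 1) // ¬ b j = j} + m = k
      rw [h1]; omega
    rw [Fintype.card_prod, Fintype.card_fin, Fintype.card_coe]
    simp only [dim] at hcard
    have h4 : k * G.κ = Fintype.card {j : Fin (k + 1) // b j ≠ j} * G.κ + m * G.κ := by
      rw [← add_mul, h3]
    omega
  let e : {j : Fin (k + 1) // b j ≠ j} × Fin G.κ ≃ A := Fintype.equivOfCardEq hcard'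
  let u' : Fin (G.dim k) → G.obj k → ℝ := fun i => if h : i ∈ A then u (e.symm ⟨i, h⟩) else 0
  have hu' : ∀ i (h : i ∈ A), u' i = u (e.symm ⟨i, h⟩) := fun i h => by simp [u', h]
  obtain ⟨c', hsub, hbd, hcu, -, hc'⟩ := c.exists_replace hdisj (u := u') hV
    (fun i hi => by rw [hu' i hi]; exact hu _)
    (fun w hwV hw h0 i hi => by rw [hu' i hi]; exact hvan w hwV ((hA w hw).2 h0) _)
    (v := fun j => if h : j ∈ A then v (e.symm ⟨j, h⟩) else 0)
    (fun i hi j hj => by simp [hu' i hi, hj, hv])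
  refine ⟨c', hsub.trans inter_subset_left, ⟨⟨fun a => ⟨e a, ?_⟩, fun a a' h => ?_⟩, ?_⟩, ?_⟩
  · rw [hbd]
    exact Finset.disjoint_left.1 hdisj (e a).2
  · exact e.injective (Subtype.ext (Subtype.mk.inj h))
  · intro a w hw
    change c'.toFun w (e a) = _
    rw [hcu w hw _ (e a).2, hu' _ (e a).2]
    simp
  · refine fun w hw => ⟨fun h => hvan w (hsub hw).1 h, fun h => ?_⟩
    refine (hA w (hsub hw).2).2 (hc' w hw fun i hi => ?_)
    rw [hu' i hi]
    exact h _

theorem pair_mem_D (i : Fin (k + 1)) (w : G.obj k) : G.pair i i w ∈ G.D := by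
  refine ⟨G.S (fun _ : Fin 1 => i) w, ?_⟩
  rw [G.S_S, pair]
  congr 1
  ext x
  fin_cases x <;> rfl

/-- The coordinate functions `z_j = ζ^{b(j)} ∘ Π_{b(j),j}` on `M[k + 1]`. -/
def linCoord (b : Fin (k + 1) → Fin (k + 1)) (ζ : Fin (k + 1) → G.obj 1 → Fin G.κ → ℝ)
    (j : Fin (k + 1)) (t : Fin G.κ) (w : G.obj k) : ℝ := ζ (b j) (G.pair (b j) j w) t

/-- The setting in which the local equations of the multidiagonals are derived: a point `q` of the
multidiagonal of `𝔓`, a choice of the representatives `b` of the parts of `𝔓` and of odd defining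
functions of the diagonal at the points `Π_{b,b}(q)`. -/
structure LocalData (𝔓 : Setoid (Fin (k + 1))) (q : G.obj k) (b : Fin (k + 1) → Fin (k + 1))
    (ζ : Fin (k + 1) → G.obj 1 → Fin G.κ → ℝ) : Prop where
  mem : q ∈ G.diagonal 𝔓
  rel : ∀ j, 𝔓 j (b j)
  eq_of_rel : ∀ i j, 𝔓 i j → b i = b j
  odd : ∀ j, G.IsOddDefining (G.pair (b j) (b j) q) (ζ (b j))

namespace LocalData

variable {G} {𝔓 : Setoid (Fin (k + 1))} {q : G.obj k} {b : Fin (k + 1) → Fin (k + 1)}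
  {ζ : Fin (k + 1) → G.obj 1 → Fin G.κ → ℝ}

theorem b_b (h : G.LocalData 𝔓 q b ζ) (j : Fin (k + 1)) : b (b j) = b j :=
  (h.eq_of_rel _ _ (h.rel j)).symm

theorem pair_eq (h : G.LocalData 𝔓 q b ζ) (j : Fin (k + 1)) :
    G.pair (b j) j q = G.pair (b j) (b j) q :=
  G.S_eq_of_mem_diagonal h.mem fun a => by
    fin_cases a
    · exact Setoid.refl' _ _
    · exact h.rel j

theorem eventually_zero (h : G.LocalData 𝔓 q b ζ) (j : Fin (k + 1)) :
    ∀ᶠ w in 𝓝 q, ζ (b j) (G.pair (b j) (b j) w) = 0 := by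
  have hc : Tendsto (G.pair (b j) (b j)) (𝓝 q) (𝓝 (G.pair (b j) (b j) q)) :=
    (G.continuous_S _).continuousAt
  filter_upwards [hc.eventually (h.odd j).2.2] with w hw
  exact hw.1 (G.pair_mem_D _ _)

theorem exists_contMDiffOn (h : G.LocalData 𝔓 q b ζ) : ∃ V ∈ 𝓝 q, ∀ j t,
    ContMDiffOn (QModel (G.dim k)) 𝓘(ℝ, ℝ) ∞ (G.linCoord b ζ j t) V := by
  choose c σ hσ using fun j => (h.odd j).1
  refine ⟨⋂ j, G.pair (b j) j ⁻¹' (c j).source, ?_, fun j t => ?_⟩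
  · refine iInter_mem.2 fun j => (G.continuous_S _).continuousAt.preimage_mem_nhds ?_
    refine (c j).source_mem_nhds ?_
    change G.pair (b j) j q ∈ _
    rw [h.pair_eq j]
    exact (c j).mem_source
  · have h1 : ContMDiffOn (QModel (G.dim 1)) 𝓘(ℝ, ℝ) ∞ (fun w => ζ (b j) w t) (c j).source :=
      ((c j).contMDiffOn_coord (σ j t)).congr fun w hw => (hσ j t w hw).symm
    exact (h1.comp (G.contMDiff_S ![b j, j]).contMDiffOn fun w hw => hw).mono
      (iInter_subset _ j)

/-- The differentials of the `z_j` with `b j ≠ j` are independent. The map which fixes `j` and moves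
all the other elements to their representatives induces a map of `M[k + 1]` fixing `q` under which
`z_j` is invariant, whereas the other `z_i` pull back to zero. Therefore it is enough to consider
a single `j`, and `Π_{b(j),j}` is a b-fibration if `b j ≠ j`. -/
theorem exists_dual (h : G.LocalData 𝔓 q b ζ) : ∃ v : Fin (k + 1) → Fin G.κ →
    EuclideanSpace ℝ (Fin (G.dim k)), ∀ j, b j ≠ j → ∀ t i s,
      dfun (G.dim k) (G.linCoord b ζ i s) q (v j t) = if i = j ∧ s = t then 1 else 0 := by
  obtain ⟨V, hV, hsm⟩ := h.exists_contMDiffOn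
  have hzd : ∀ i s, MDifferentiableAt (QModel (G.dim k)) 𝓘(ℝ, ℝ) (G.linCoord b ζ i s) q :=
    fun i s => ((hsm i s).contMDiffAt hV).mdifferentiableAt (by simp)
  have key : ∀ j, b j ≠ j → ∀ t, ∃ v, ∀ i s,
      dfun (G.dim k) (G.linCoord b ζ i s) q v = if i = j ∧ s = t then 1 else 0 := by
    intro j hj t
    -- the b-fibration `Π_{b j,j}` provides a vector; the map `e` removes its effect on the
    -- other `z_i`
    have hodd : G.IsOddDefining (G.pair (b j) j q) (ζ (b j)) := by
      rw [h.pair_eq]; exact h.odd j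
    obtain ⟨⟨c, σ, hσ⟩, -, -⟩ := hodd
    obtain ⟨v, hv⟩ := (G.bFibration (m := k) (n := 1) ![b j, j] (by
      intro x y hxy
      fin_cases x <;> fin_cases y <;> simp_all [eq_comm])).vec_mem_range q c (σ t).2
    let e : Fin (k + 1) → Fin (k + 1) := fun i => if i = j then j else b i
    have heq : G.S e q = q := by
      conv_rhs => rw [← G.S_id_apply q]
      refine G.S_eq_of_mem_diagonal h.mem fun i => ?_
      by_cases hi : i = j
      · simp [e, hi]
      · simpa [e, hi] using Setoid.symm' 𝔓 (h.rel i)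
    have heb : ∀ i, e (b i) = b i := by
      intro i
      have : b i ≠ j := fun hij => hj (by rw [← hij, h.b_b])
      simp [e, this, h.b_b]
    refine ⟨G.dS e q v, fun i s => ?_⟩
    have hcomp : dfun (G.dim k) (G.linCoord b ζ i s) q (G.dS e q v) =
        dfun (G.dim k) (fun w => G.linCoord b ζ i s (G.S e w)) q v := by
      rw [dfun_comp (heq.symm ▸ hzd i s) (G.mdifferentiableAt_S e q), heq]
      rfl
    rw [hcomp]
    by_cases hi : i = j
    · subst hi
      have h1 : (fun w => G.linCoord b ζ i s (G.S e w)) =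
          fun w => (fun x => ζ (b i) x s) (G.S (m := k) (n := 1) ![b i, i] w) := by
        funext w
        simp only [linCoord, pair, G.S_S]
        congr 2
        ext x
        fin_cases x
        · simp [heb]
        · simp [e]
      have h2 : (fun x => ζ (b i) x s) =ᶠ[𝓝 (G.S (m := k) (n := 1) ![b i, i] q)]
          fun w => c.toFun w (σ s) := by
        filter_upwards [c.source_mem_nhds c.mem_source] with w hw
        exact (hσ s w hw).symm
      have h3 : MDifferentiableAt (QModel (G.dim 1)) 𝓘(ℝ, ℝ) (fun x => ζ (b i) x s)
          (G.S (m := k) (n := 1) ![b i, i] q) :=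
        (c.mdifferentiableAt_coord c.mem_source (σ s)).congr_of_eventuallyEq h2
      rw [h1, dfun_comp (g := fun x => ζ (b i) x s) h3 (G.mdifferentiableAt_S _ q),
        dfun_eq_of_eventuallyEq h2, ContinuousLinearMap.comp_apply, hv]
      have h4 := c.dfun_coord_vec (σ s) (σ t)
      refine h4.trans ?_
      simp [← Subtype.ext_iff]
    · rw [dfun_eq_zero_of_eventually]
      · simp [hi]
      · filter_upwards [h.eventually_zero i] with w hw
        simp only [linCoord, pair, G.S_S]
        refine Eq.trans ?_ (congrFun hw s)
        rw [pair]
        congr 2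
        ext x
        fin_cases x
        · simp [heb]
        · simp [e, hi]
  choose! v hv using key
  exact ⟨v, fun j hj t => hv j hj t⟩

/-- A finer partition has representatives among which are those of the coarser one. -/
theorem exists_representatives (h : G.LocalData 𝔓 q b ζ) {𝔔 : Setoid (Fin (k + 1))}
    (hQ : 𝔔 ≤ 𝔓) : ∃ b' : Fin (k + 1) → Fin (k + 1), (∀ j, 𝔔 j (b' j)) ∧
      (∀ i j, 𝔔 i j → b' i = b' j) ∧ ∀ j, b' (b j) = b j := by
  classical
  refine ⟨fun j => if 𝔔 j (b j) then b j else (Quotient.mk 𝔔 j).out, fun j => ?_,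
    fun i j hij => ?_, fun j => ?_⟩
  · dsimp only
    split_ifs with hj
    · exact hj
    · exact Setoid.symm' _ (Quotient.exact (Quotient.out_eq (Quotient.mk 𝔔 j)))
  · have h1 : b i = b j := h.eq_of_rel i j (hQ hij)
    have h2 : 𝔔 i (b i) ↔ 𝔔 j (b j) := by
      rw [h1]
      exact ⟨Setoid.trans' _ (Setoid.symm' _ hij), Setoid.trans' _ hij⟩
    have h3 : Quotient.mk 𝔔 i = Quotient.mk 𝔔 j := Quotient.sound hij
    rw [h1] at h2
    simp only [h1, h2, h3]
  · simp [h.b_b]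

theorem linCoord_eq (h : G.LocalData 𝔓 q b ζ) {𝔔 : Setoid (Fin (k + 1))} (hQ : 𝔔 ≤ 𝔓)
    {w : G.obj k} (hw : w ∈ G.diagonal 𝔔) {i j : Fin (k + 1)} (hij : 𝔔 i j) (t : Fin G.κ) :
    G.linCoord b ζ i t w = G.linCoord b ζ j t w := by
  have h1 : G.pair (b i) i w = G.pair (b i) j w :=
    G.S_eq_of_mem_diagonal hw fun a => by
      fin_cases a
      · exact Setoid.refl' _ _
      · exact hij
  rw [linCoord, linCoord, h1, h.eq_of_rel i j (hQ hij)]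

theorem eventually_mem_diagonal_iff (h : G.LocalData 𝔓 q b ζ) {𝔔 : Setoid (Fin (k + 1))}
    (hQ : 𝔔 ≤ 𝔓) : ∀ᶠ w in 𝓝 q, w ∈ G.diagonal 𝔔 ↔
      ∀ i j, 𝔔 i j → ∀ t, G.linCoord b ζ i t w = G.linCoord b ζ j t w := by
  obtain ⟨V, hV, hsm⟩ := h.exists_contMDiffOn
  obtain ⟨v, hv⟩ := h.exists_dual
  obtain ⟨b', hb'1, hb'2, hb'b⟩ := h.exists_representatives hQ
  have hne : ∀ j, b' j ≠ j → b j ≠ j := fun j hj hbj => hj (by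
    have := hb'b j
    rwa [hbj] at this)
  have hd : ∀ i s, MDifferentiableAt (QModel (G.dim k)) 𝓘(ℝ, ℝ) (G.linCoord b ζ i s) q :=
    fun i s => ((hsm i s).contMDiffAt hV).mdifferentiableAt (by simp)
  obtain ⟨c, -, -, hc⟩ := G.exists_coords_of_defining (G.diagonal_anti hQ h.mem) hb'1 hb'2
    (u := fun a w => G.linCoord b ζ a.1 a.2 w - G.linCoord b ζ (b' a.1) a.2 w) hV
    (fun a => (hsm _ _).sub (hsm _ _))
    (fun w _ hw a => sub_eq_zero.2 (h.linCoord_eq hQ hw (hb'1 _) _))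
    (v := fun a => v a.1 a.2) (fun a a' => by
      have h1 : b' a.1 ≠ a'.1 := fun h1 => a'.1.2 (by
        rw [← h1]; exact (hb'2 _ _ (hb'1 _)).symm)
      rw [dfun_sub (hd _ _) (hd _ _), sub_apply, hv _ (hne _ a'.1.2), hv _ (hne _ a'.1.2)]
      simp [h1, Prod.ext_iff, Subtype.ext_iff])
  filter_upwards [c.source_mem_nhds c.mem_source] with w hw
  refine ⟨fun hw i j hij t => h.linCoord_eq hQ hw hij t, fun hl => (hc w hw).2 fun a => ?_⟩
  exact sub_eq_zero.2 (hl _ _ (hb'1 _) _)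

/-- The `z_j` with `b j ≠ j` are interior coordinates near `q` in which the multidiagonals are
linear. -/
theorem exists_adaptedCoords (h : G.LocalData 𝔓 q b ζ) : ∃ c : AdaptedCoords (G.dim k) q,
    c.IncludesInterior (fun (a : {j : Fin (k + 1) // b j ≠ j} × Fin G.κ) w =>
      G.linCoord b ζ a.1 a.2 w) ∧
    (∀ 𝔔 ≤ 𝔓, ∀ w ∈ c.source, w ∈ G.diagonal 𝔔 ↔
      ∀ i j, 𝔔 i j → ∀ t, G.linCoord b ζ i t w = G.linCoord b ζ j t w) ∧
    ∀ w ∈ c.source, ∀ j t, G.linCoord b ζ (b j) t w = 0 := by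
  obtain ⟨V, hV, hsm⟩ := h.exists_contMDiffOn
  obtain ⟨v, hv⟩ := h.exists_dual
  have h1 : ∀ᶠ w in 𝓝 q, ∀ 𝔔 : {𝔔 : Setoid (Fin (k + 1)) // 𝔔 ≤ 𝔓}, w ∈ G.diagonal 𝔔.1 ↔
      ∀ i j, 𝔔.1 i j → ∀ t, G.linCoord b ζ i t w = G.linCoord b ζ j t w :=
    eventually_all.2 fun 𝔔 => h.eventually_mem_diagonal_iff 𝔔.2
  have h2 : ∀ᶠ w in 𝓝 q, ∀ j t, G.linCoord b ζ (b j) t w = 0 := by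
    refine eventually_all.2 fun j => ?_
    filter_upwards [h.eventually_zero j] with w hw t
    rw [linCoord, h.b_b, hw]; rfl
  have hV' := inter_mem hV (inter_mem h1 h2)
  obtain ⟨c, hcV, hci, -⟩ := G.exists_coords_of_defining h.mem h.rel h.eq_of_rel
    (u := fun a w => G.linCoord b ζ a.1 a.2 w) hV'
    (fun a => (hsm _ _).mono inter_subset_left)
    (fun w hw hwD a => by
      rw [h.linCoord_eq le_rfl hwD (h.rel _)]
      exact hw.2.2 _ _)
    (v := fun a => v a.1 a.2) (fun a a' => by
      rw [hv _ a'.1.2]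
      simp [Prod.ext_iff, Subtype.ext_iff])
  exact ⟨c, hci, fun 𝔔 hQ w hw => (hcV hw).2.1 ⟨𝔔, hQ⟩, fun w hw => (hcV hw).2.2⟩

end LocalData

end LocalEquations

/-! ### Clean intersection and transversality -/

variable {k : ℕ}

theorem exists_odd_family (q : G.obj k) : ∃ ζ : Fin (k + 1) → G.obj 1 → Fin G.κ → ℝ,
    ∀ j, G.IsOddDefining (G.pair j j q) (ζ j) :=
  ⟨_, fun j => (G.exists_isOddDefining (G.pair_mem_D j q)).choose_spec⟩

theorem exists_localData (q : G.obj k) : ∃ b ζ, G.LocalData (G.coarsest q) q b ζ := by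
  obtain ⟨ζ, hζ⟩ := G.exists_odd_family q
  refine ⟨fun j => (Quotient.mk (G.coarsest q) j).out, ζ, ⟨G.mem_diagonal_iff.2 le_rfl,
    fun j => ?_, fun i j hij => ?_, fun j => hζ _⟩⟩
  · exact Setoid.symm' _ (Quotient.exact (Quotient.out_eq (Quotient.mk (G.coarsest q) j)))
  · have : Quotient.mk (G.coarsest q) i = Quotient.mk (G.coarsest q) j := Quotient.sound hij
    simp only [this]

theorem trueDiagonals_subset : G.trueDiagonals k ⊆ G.multidiagonals k := by
  rintro _ ⟨P, -, rfl⟩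
  exact ⟨_, rfl⟩

/-- Near a point the multidiagonals through it belong to partitions finer than the coarsest one, and
all of these are linear in the same coordinates. -/
theorem isPClean_of_subset {𝒟 : Set (Set (G.obj k))} (h𝒟 : 𝒟 ⊆ G.multidiagonals k) :
    IsPClean (G.dim k) 𝒟 := by
  refine ⟨(finite_range (G.diagonal (k := k))).subset fun X hX => ?_, fun X hX => ?_, ?_⟩
  · obtain ⟨𝔓, rfl⟩ := h𝒟 hX
    exact ⟨𝔓, rfl⟩
  · obtain ⟨𝔓, rfl⟩ := h𝒟 hX
    obtain ⟨m, I, hI, rfl⟩ := exists_surjective_ker 𝔓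
    rw [G.diagonal_eq_range I hI]
    exact (G.pEmbedding I hI).2.1
  · intro p _
    obtain ⟨b, ζ, h⟩ := G.exists_localData p
    obtain ⟨c, ⟨σ, hσ⟩, hc, hc0⟩ := h.exists_adaptedCoords
    let φ : Fin (k + 1) → Fin G.κ → ({i : Fin (G.dim k) // i ∉ c.bdry} → ℝ) →ₗ[ℝ] ℝ :=
      fun j t => if hj : b j ≠ j then LinearMap.proj (σ (⟨j, hj⟩, t)) else 0
    have hφ : ∀ w ∈ c.source, ∀ j t, φ j t (fun i => c.toFun w i) = G.linCoord b ζ j t w := by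
      intro w hw j t
      by_cases hj : b j = j
      · rw [← hj, hc0 w hw]
        simp [φ, h.b_b]
      · simpa [φ, hj] using hσ (⟨j, hj⟩, t) w hw
    refine ⟨c, fun X hX hpX => ?_⟩
    obtain ⟨𝔔, rfl⟩ := h𝒟 hX
    refine ⟨∅, Finset.empty_subset _, {ℓ | ∃ i j t, 𝔔 i j ∧ ℓ = φ i t - φ j t}, fun w hw => ?_⟩
    rw [hc 𝔔 (G.mem_diagonal_iff.1 hpX) w hw]
    constructor
    · rintro hl
      refine ⟨by simp, ?_⟩
      rintro _ ⟨i, j, t, hij, rfl⟩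
      rw [LinearMap.sub_apply, hφ w hw, hφ w hw, hl i j hij t, sub_self]
    · rintro ⟨-, hl⟩ i j hij t
      have := hl _ ⟨i, j, t, hij, rfl⟩
      rwa [LinearMap.sub_apply, hφ w hw, hφ w hw, sub_eq_zero] at this

/-- The true diagonals of disjoint sets are transversal: every coordinate ray lies in one of
them, since a coordinate enters the linear equations of at most one of them. -/
theorem areTransversal_of_disjoint {P Q : Finset (Fin (k + 1))} (hPQ : Disjoint P Q) :
    AreTransversal (G.dim k) (G.diagonal (singlePart P)) (G.diagonal (singlePart Q)) := by
  intro p hp f g hf hg hfX hgY hfg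
  change dfun (G.dim k) f p = dfun (G.dim k) g p at hfg
  change dfun (G.dim k) f p = 0
  obtain ⟨b, ζ, h⟩ := G.exists_localData p
  obtain ⟨c, ⟨σ, hσ⟩, hc, hc0⟩ := h.exists_adaptedCoords
  have key : ∀ (S : Finset (Fin (k + 1))) (f : G.obj k → ℝ), p ∈ G.diagonal (singlePart S) →
      ContMDiffAt (QModel (G.dim k)) 𝓘(ℝ, ℝ) ∞ f p →
      (∀ᶠ w in 𝓝[G.diagonal (singlePart S)] p, f w = 0) →
      ∀ i, (∀ a, (a.1 : Fin (k + 1)) ∈ S → (σ a : Fin (G.dim k)) ≠ i) →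
        dfun (G.dim k) f p (c.vec i) = 0 := by
    intro S f hpS hf hfS i hi
    rw [eventually_nhdsWithin_iff] at hfS
    refine c.dfun_vec_eq_zero_of_ray (hf.mdifferentiableAt (by simp)) (hfS.self_of_nhds hpS) ?_
    filter_upwards [c.eventually_ray i hfS,
      eventually_smul_single_mem_cornerCube (B := c.bdry) c.ε_pos i] with s hs hsc
    refine hs ((hc _ (G.mem_diagonal_iff.1 hpS) _ (c.map_target hsc)).2 ?_)
    have hzero : ∀ j ∈ S, ∀ t, G.linCoord b ζ j t
        (c.invFun (s • EuclideanSpace.single i (1 : ℝ))) = 0 := by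
      intro j hj t
      by_cases hbj : b j = j
      · rw [← hbj, hc0 _ (c.map_target hsc)]
      · refine (hσ (⟨j, hbj⟩, t) _ (c.map_target hsc)).symm.trans ?_
        rw [c.right_inv hsc]
        simp [hi (⟨j, hbj⟩, t) hj]
    rintro j l (rfl | ⟨hj, hl⟩) t
    · rfl
    · rw [hzero j hj, hzero l hl]
  have hvec : ∀ i, dfun (G.dim k) f p (c.vec i) = 0 := by
    intro i
    by_cases hi : ∀ a, (a.1 : Fin (k + 1)) ∈ P → (σ a : Fin (G.dim k)) ≠ i
    · exact key P f hp.1 hf hfX i hi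
    · rw [hfg]
      refine key Q g hp.2 hg hgY i fun a ha hai => hi fun a' ha' hai' => ?_
      have : a = a' := σ.injective (Subtype.ext (hai.trans hai'.symm))
      exact Finset.disjoint_left.1 hPQ ha' (this ▸ ha)
  ext v
  rw [c.eq_sum_vec v, map_sum]
  simp [hvec]

end GeneralizedProduct

theorem mainTheorem2 (G : GeneralizedProduct) (hG : G.IsCompactProduct) (k : ℕ) :
    -- the multidiagonals of `M[k + 1]`
    (IsPClean (G.dim k) (G.multidiagonals k) ∧
      ∀ X ∈ G.multidiagonals k, ∀ Y ∈ G.multidiagonals k, X ∩ Y ∈ G.multidiagonals k) ∧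
    -- the true diagonals
    (IsPClean (G.dim k) (G.trueDiagonals k) ∧
      ∀ X ∈ G.trueDiagonals k, ∀ Y ∈ G.trueDiagonals k,
        ¬ AreTransversal (G.dim k) X Y → X ∩ Y ∈ G.trueDiagonals k) ∧
    -- linear equations in odd coordinates near a point `q` of `D_𝔓`, where `b j` is the chosen
    -- representative of the part of `𝔓` that contains `j`
    ∀ (𝔓 : Setoid (Fin (k + 1))), ∀ q ∈ G.diagonal 𝔓, ∀ b : Fin (k + 1) → Fin (k + 1),
      (∀ j, 𝔓 j (b j)) → (∀ i j, 𝔓 i j → b i = b j) →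
      ∃ ζ : Fin (k + 1) → G.obj 1 → Fin G.κ → ℝ,
        (∀ j, G.IsOddDefining (G.pair (b j) (b j) q) (ζ (b j))) ∧
        ∃ c : AdaptedCoords (G.dim k) q,
          (c.IncludesInterior fun (a : {j : Fin (k + 1) // b j ≠ j} × Fin G.κ) w =>
            ζ (b a.1) (G.pair (b a.1) a.1 w) a.2) ∧
          ∀ 𝔔 ≤ 𝔓, ∀ w ∈ c.source, w ∈ G.diagonal 𝔔 ↔
            ∀ i j, 𝔔 i j → ζ (b i) (G.pair (b i) i w) = ζ (b j) (G.pair (b j) j w) := by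
  refine ⟨⟨G.isPClean_of_subset subset_rfl, ?_⟩, ⟨G.isPClean_of_subset G.trueDiagonals_subset, ?_⟩,
    fun 𝔓 q hq b hb hb' => ?_⟩
  · rintro _ ⟨𝔓, rfl⟩ _ ⟨𝔔, rfl⟩
    exact ⟨_, G.diagonal_inter 𝔓 𝔔⟩
  · rintro _ ⟨P, hP, rfl⟩ _ ⟨Q, -, rfl⟩ hPQ
    have hne : (P ∩ Q).Nonempty := Finset.not_disjoint_iff_nonempty_inter.1 fun h =>
      hPQ (G.areTransversal_of_disjoint h)
    refine ⟨P ∪ Q, hP.trans (Finset.card_le_card Finset.subset_union_left), ?_⟩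
    rw [G.diagonal_inter, GeneralizedProduct.singlePart_sup hne]
  · obtain ⟨ζ, hζ⟩ := G.exists_odd_family q
    have h : G.LocalData 𝔓 q b ζ := ⟨hq, hb, hb', fun j => hζ (b j)⟩
    obtain ⟨c, hci, hc, -⟩ := h.exists_adaptedCoords
    refine ⟨ζ, fun j => hζ (b j), c, hci, fun 𝔔 hQ w hw => (hc 𝔔 hQ w hw).trans ?_⟩
    exact forall₃_congr fun i j _ => funext_iff.symm
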